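/- **Conventions.** Let $R$ be an associative ring with $1$ and with an involution $a\mapsto\bar a$ (additive, $\overline{ab}=\bar b\,\bar a$, $\bar{\bar a}=a$). Let $\lambda\in C(R)$ (the center of $R$) with $\lambda\bar\lambda=1$, and let $\Lambda\subseteq R$ be a $\lambda$-form parameter: an additive subgroup with $\{a-\lambda\bar a\mid a\in R\}\subseteq\Lambda\subseteq\{a\in R\mid a=-\lambda\bar a\}$ and $\bar x\Lambda x\subseteq\Lambda$ for all $x\in R$. Write $\psi_n=\begin{pmatrix}0&I_n\\ \lambda I_n&0\end{pmatrix}$, let $\sigma^*$ be the conjugate transpose of $\sigma$, and set $\rho(i)=n+i$ for $1\le i\le n$. * $\mathrm{GQ}(2n,R,\Lambda)=\{\sigma\in \mathrm{GL}(2n,R)\mid \sigma^*\psi_n\sigma=\psi_n\}$. * $\mathrm{EQ}(2n,R,\Lambda)$ is the subgroup of $\mathrm{GL}(2n,R)$ generated by the matrices $I+ae_{ij}-\bar a e_{\rho(j)\rho(i)}$, $\;I+ae_{i\rho(j)}-\bar\lambda\bar a e_{j\rho(i)}$, $\;I+ae_{\rho(i)j}-\lambda\bar a e_{\rho(j)i}$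 for $1\le i\ne j\le n$ and $a\in R$, and by $I+\bar a e_{i\rho(i)}$, $\;I+ae_{\rho(i)i}$ for $1\le i\le n$ and $a\in\Lambda$. For a multiplicative set $S$ of central elements of $R$ with $\bar S=S$, the ring $S^{-1}R$ has the involution $\overline{a/s}=\bar a/\bar s$ and the form parameter $S^{-1}\Lambda=\{a/(\bar s s)\mid a\in\Lambda,\ s\in S\}$ (with respect to $\lambda/1$). Let $R=R_0\oplus R_1\oplus R_2\oplus\cdots$ be graded by $\mathbb{N}$, with $R_+=R_1\oplus R_2\oplus\cdots$, such that the form ring $(R,\Lambda)$ is graded: $\overline{R_i}\subseteq R_i$ for all $i$, $\lambda\in R_0$, and $\Lambda$ contains the homogeneous components of each of its elements. For a maximal ideal $\mathfrak m$ of $C(R_0)$ put $S_{\mathfrak m}=\{z\in C(R)\mid z,\bar z\in C(R_0)\setminus\mathfrak m\}$ (so $S_{\mathfrak m}=C(R_0)\setminus\mathfrak m$ if $C(R_0)\subseteq C(R)$ and $\bar{\mathfrak m}=\mathfrak m$), $R_{\mathfrak m}=S_{\mathfrak m}^{-1}R$ and $\Lambda_{\mathfrak m}=S_{\mathfrak m}^{-1}\Lambda$,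 and let $\alpha_{\mathfrak m}$ be the image of a matrix $\alpha$ over $R_{\mathfrak m}$. **Theorem (Graded Local-Global Principle).** Let $(R,\Lambda)$ be a graded form ring as above such that $R$ is almost commutative, i.e. finitely generated as a module over $C(R)$, and let $n\ge 3$. Let $\alpha\in \mathrm{GQ}(2n,R,\Lambda)$ with $\alpha\equiv I_{2n}\pmod{R_+}$. If $\alpha_{\mathfrak m}\in \mathrm{EQ}(2n,R_{\mathfrak m},\Lambda_{\mathfrak m})$ for every maximal ideal $\mathfrak m$ of $C(R_0)$, then $\alpha\in \mathrm{EQ}(2n,R,\Lambda)$. -/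

import Mathlib

namespace GradedLG

open Matrix

section FormRings

variable {R : Type*} [Ring R] [StarRing R]

/-- `Λ` is a `lam`-form parameter on the ring with involution `R` (the involution is `star`), i.e.
`(R, Λ)` is a form ring: `lam` is central with `lam * star lam = 1`, and `Λ` is an additive
subgroup with `Λ_min ≤ Λ ≤ Λ_max` that is closed under `a ↦ star x * a * x`. -/
structure IsFormParameter (lam : R) (Λ : AddSubgroup R) : Prop where
  lam_central : lam ∈ Subring.center R
  lam_mul_star : lam * star lam = 1
  min_le : ∀ a : R, a - lam * star a ∈ Λ
  le_max : ∀ a ∈ Λ, a = -(lam * star a)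
  conj_mem : ∀ x : R, ∀ a ∈ Λ, star x * a * x ∈ Λ

/-- The matrix `ψ_n`, with blocks `0, I_n, lam I_n, 0`. The index type `Fin n ⊕ Fin n` stands for
`{1, …, 2n}`, with `ρ (inl i) = inr i`. -/
def psi (n : ℕ) (lam : R) : Matrix (Fin n ⊕ Fin n) (Fin n ⊕ Fin n) R :=
  Matrix.fromBlocks 0 1 (Matrix.diagonal fun _ => lam) 0

/-- The general quadratic group: the `σ ∈ GL(2n, R)` with `σᴴ ψ_n σ = ψ_n`. -/
def GQ (n : ℕ) (lam : R) : Subgroup (Matrix (Fin n ⊕ Fin n) (Fin n ⊕ Fin n) R)ˣ where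
  carrier := {σ | (σ.val)ᴴ * psi n lam * σ.val = psi n lam}
  one_mem' := by simp
  mul_mem' := by
    intro σ τ hσ hτ
    simp only [Set.mem_ofPred_eq] at hσ hτ ⊢
    calc ((σ * τ).val)ᴴ * psi n lam * (σ * τ).val
        = (τ.val)ᴴ * ((σ.val)ᴴ * psi n lam * σ.val) * τ.val := by
          simp only [Units.val_mul, Matrix.conjTranspose_mul, mul_assoc]
      _ = psi n lam := by rw [hσ, hτ]
  inv_mem' := by
    intro σ hσ
    simp only [Set.mem_ofPred_eq] at hσ ⊢
    have h1 : σ.val * (σ⁻¹).val = 1 := σ.mul_inv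
    have h2 : ((σ⁻¹).val)ᴴ * (σ.val)ᴴ = 1 := by
      rw [← Matrix.conjTranspose_mul, h1, Matrix.conjTranspose_one]
    calc ((σ⁻¹).val)ᴴ * psi n lam * (σ⁻¹).val
        = ((σ⁻¹).val)ᴴ * ((σ.val)ᴴ * psi n lam * σ.val) * (σ⁻¹).val := by rw [hσ]
      _ = (((σ⁻¹).val)ᴴ * (σ.val)ᴴ) * psi n lam * (σ.val * (σ⁻¹).val) := by
          simp only [mul_assoc]
      _ = psi n lam := by rw [h1, h2]; simp

/-- The matrices `qε_ij(a)`, `i ≠ j`. -/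
def qeps (n : ℕ) (i j : Fin n) (a : R) : Matrix (Fin n ⊕ Fin n) (Fin n ⊕ Fin n) R :=
  Matrix.fromBlocks (1 + Matrix.single i j a) 0 0 (1 - Matrix.single j i (star a))

/-- The matrices `qr_ij(a)`, `i ≠ j`. -/
def qr (n : ℕ) (lam : R) (i j : Fin n) (a : R) :
    Matrix (Fin n ⊕ Fin n) (Fin n ⊕ Fin n) R :=
  Matrix.fromBlocks 1 (Matrix.single i j a - Matrix.single j i (star lam * star a)) 0 1

/-- The matrices `ql_ij(a)`, `i ≠ j`. -/
def ql (n : ℕ) (lam : R) (i j : Fin n) (a : R) :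
    Matrix (Fin n ⊕ Fin n) (Fin n ⊕ Fin n) R :=
  Matrix.fromBlocks 1 0 (Matrix.single i j a - Matrix.single j i (lam * star a)) 1

/-- The matrices `qr_ii(a)`. -/
def qrDiag (n : ℕ) (i : Fin n) (a : R) : Matrix (Fin n ⊕ Fin n) (Fin n ⊕ Fin n) R :=
  Matrix.fromBlocks 1 (Matrix.single i i a) 0 1

/-- The matrices `ql_ii(a)`. -/
def qlDiag (n : ℕ) (i : Fin n) (a : R) : Matrix (Fin n ⊕ Fin n) (Fin n ⊕ Fin n) R :=
  Matrix.fromBlocks 1 0 (Matrix.single i i a) 1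

/-- The elementary quadratic group `EQ(2n, R, Λ)`. With the form `ψ_n`, the parameter of the lower
long root matrices `ql_ii` runs over `Λ`, that of the upper ones `qr_ii` over `{star a | a ∈ Λ}`. -/
def EQ (n : ℕ) (lam : R) (Λ : AddSubgroup R) :
    Subgroup (Matrix (Fin n ⊕ Fin n) (Fin n ⊕ Fin n) R)ˣ :=
  Subgroup.closure
    {g | (∃ (i j : Fin n) (a : R), i ≠ j ∧
            (g.val = qeps n i j a ∨ g.val = qr n lam i j a ∨ g.val = ql n lam i j a)) ∨
         (∃ (i : Fin n), ∃ a ∈ Λ, g.val = qrDiag n i (star a) ∨ g.val = qlDiag n i a)}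

end FormRings

section CentralLocalization

variable {R : Type*} [Ring R] [StarRing R]

/-- The involution of `R` restricted to the center. -/
def centerStar (z : Subring.center R) : Subring.center R :=
  ⟨star (z : R), Subring.mem_center_iff.2 fun g => by
    have h := congrArg star (Subring.mem_center_iff.1 z.2 (star g))
    simpa using h.symm⟩

@[simp] theorem coe_centerStar (z : Subring.center R) :
    (centerStar z : R) = star (z : R) := rfl

/-- A multiplicative set of central elements that is stable under the involution. -/
class IsStarStable (S : Submonoid (Subring.center R)) : Prop where
  star_mem : ∀ z ∈ S, centerStar z ∈ S

variable (S : Submonoid (Subring.center R)) [IsStarStable S]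

/-- The involution on a multiplicative set stable under it. -/
def setStar (s : S) : S := ⟨centerStar s.1, IsStarStable.star_mem s.1 s.2⟩

@[simp] theorem coe_setStar (s : S) :
    (((setStar S s : S) : Subring.center R) : R) = star ((s : Subring.center R) : R) := rfl

theorem setStar_mul (s t : S) : setStar S (s * t) = setStar S s * setStar S t := by
  apply Subtype.ext; apply Subtype.ext
  have h : ((s : Subring.center R) : R) * ((t : Subring.center R) : R)
      = ((t : Subring.center R) : R) * ((s : Subring.center R) : R) :=
    Subring.mem_center_iff.1 t.1.2 _
  simp [h]

theorem setStar_setStar (s : S) : setStar S (setStar S s) = s := by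
  apply Subtype.ext; apply Subtype.ext
  simp

theorem star_smul_center (z : Subring.center R) (r : R) :
    star (z • r) = centerStar z • star r := by
  have h : star r * star (z : R) = star (z : R) * star r :=
    Subring.mem_center_iff.1 (centerStar z).2 (star r)
  simp only [Subring.smul_def, smul_eq_mul, coe_centerStar, star_mul, h]

/-- The involution of `S⁻¹R`: `star (a / s) = star a / star s`. -/
noncomputable instance : Star (LocalizedModule S R) where
  star x := LocalizedModule.liftOn x
    (fun p => LocalizedModule.mk (star p.1) (setStar S p.2)) (by
      rintro ⟨a, s⟩ ⟨b, t⟩ h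
      obtain ⟨u, hu⟩ := h
      refine LocalizedModule.mk_eq.2 ⟨setStar S u, ?_⟩
      have hu' := congrArg star hu
      simp only [Submonoid.smul_def, star_smul_center] at hu'
      exact hu')

theorem star_mk (a : R) (s : S) :
    star (LocalizedModule.mk a s : LocalizedModule S R)
      = LocalizedModule.mk (star a) (setStar S s) :=
  LocalizedModule.liftOn_mk _ a s

noncomputable instance : StarRing (LocalizedModule S R) where
  star_involutive x := by
    induction x using LocalizedModule.induction_on with
    | h a s => simp [star_mk, setStar_setStar]
  star_mul x y := by
    induction x using LocalizedModule.induction_on with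
    | h a s =>
      induction y using LocalizedModule.induction_on with
      | h b t =>
        simp only [LocalizedModule.mk_mul_mk, star_mk, star_mul, setStar_mul]
        rw [mul_comm (setStar S s)]
  star_add x y := by
    induction x using LocalizedModule.induction_on with
    | h a s =>
      induction y using LocalizedModule.induction_on with
      | h b t =>
        simp only [LocalizedModule.mk_add_mk, star_mk, star_add, setStar_mul,
          Submonoid.smul_def, star_smul_center]
        rfl

/-- The localization map `R → S⁻¹R`, `a ↦ a / 1`. -/
noncomputable def locMap (S : Submonoid (Subring.center R)) : R →+* LocalizedModule S R where
  toFun a := LocalizedModule.mk a 1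
  map_one' := by with_unfolding_all rfl
  map_mul' a b := by simp [LocalizedModule.mk_mul_mk]
  map_zero' := LocalizedModule.zero_mk 1
  map_add' a b := by simp

/-- The form parameter of `S⁻¹R` induced by `Λ`: it consists of the elements
`a / (star s * s) = star (1 / s) * a * (1 / s)` with `a ∈ Λ`, `s ∈ S`. -/
noncomputable def locParam (Λ : AddSubgroup R) : AddSubgroup (LocalizedModule S R) :=
  AddSubgroup.closure {x | ∃ a ∈ Λ, ∃ s : S, x = LocalizedModule.mk a (setStar S s * s)}

/-- The image in `GL(2n, S⁻¹R)` of a matrix in `GL(2n, R)`. -/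
noncomputable def locGL (S : Submonoid (Subring.center R)) (n : ℕ) :
    (Matrix (Fin n ⊕ Fin n) (Fin n ⊕ Fin n) R)ˣ →*
      (Matrix (Fin n ⊕ Fin n) (Fin n ⊕ Fin n) (LocalizedModule S R))ˣ :=
  Units.map ((locMap S).mapMatrix : Matrix (Fin n ⊕ Fin n) (Fin n ⊕ Fin n) R →+*
    Matrix (Fin n ⊕ Fin n) (Fin n ⊕ Fin n) (LocalizedModule S R)).toMonoidHom

end CentralLocalization

section Graded

variable {R : Type*} [Ring R] (𝒜 : ℕ → AddSubgroup R) [GradedRing 𝒜]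

/-- `x` is an element of `C(R_0)` (the center of the degree-zero part) outside `m`. -/
def IsOutside (m : MaximalSpectrum (Subring.center (𝒜 0))) (x : R) : Prop :=
  ∃ c : Subring.center (𝒜 0), ((c : 𝒜 0) : R) = x ∧ c ∉ m.asIdeal

variable {𝒜} in
theorem IsOutside.mul {m : MaximalSpectrum (Subring.center (𝒜 0))} {x y : R}
    (hx : IsOutside 𝒜 m x) (hy : IsOutside 𝒜 m y) : IsOutside 𝒜 m (x * y) := by
  obtain ⟨c, rfl, hc⟩ := hx
  obtain ⟨d, rfl, hd⟩ := hy
  refine ⟨c * d, rfl, fun h => ?_⟩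
  rcases m.isMaximal.isPrime.mem_or_mem h with h | h
  · exact hc h
  · exact hd h

theorem IsOutside.one (m : MaximalSpectrum (Subring.center (𝒜 0))) : IsOutside 𝒜 m (1 : R) :=
  ⟨1, rfl, fun h => m.isMaximal.ne_top ((Ideal.eq_top_iff_one _).2 h)⟩

variable [StarRing R]

/-- The set at which `R` is localized to form `R_m`. Localizing the ring with involution `R` at
`C(R_0) \ m` requires that this set be central in `R` and stable under the involution, and then
`locSet 𝒜 m` is this very set (see `mem_locSet_iff`). In general `locSet 𝒜 m` is the
largest subset of `C(R_0) \ m` with these two properties. -/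
def locSet (m : MaximalSpectrum (Subring.center (𝒜 0))) : Submonoid (Subring.center R) where
  carrier := {z | IsOutside 𝒜 m (z : R) ∧ IsOutside 𝒜 m (star (z : R))}
  one_mem' := by
    refine ⟨IsOutside.one 𝒜 m, ?_⟩
    simpa using IsOutside.one 𝒜 m
  mul_mem' := by
    rintro z w ⟨hz, hz'⟩ ⟨hw, hw'⟩
    refine ⟨hz.mul hw, ?_⟩
    simpa using hw'.mul hz'

instance (m : MaximalSpectrum (Subring.center (𝒜 0))) : IsStarStable (locSet 𝒜 m) where
  star_mem := by
    rintro z ⟨hz, hz'⟩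
    exact ⟨hz', by simpa using hz⟩

/-- If `C(R_0)` is central in `R` and the complement of `m` in `C(R_0)` is stable under the
involution, then `locSet 𝒜 m` is the complement of `m` in `C(R_0)`. -/
theorem mem_locSet_iff (m : MaximalSpectrum (Subring.center (𝒜 0)))
    (hC : ∀ c : Subring.center (𝒜 0), ((c : 𝒜 0) : R) ∈ Subring.center R)
    (hm : ∀ x : R, IsOutside 𝒜 m x → IsOutside 𝒜 m (star x)) (x : R) :
    (∃ z ∈ locSet 𝒜 m, (z : R) = x) ↔ IsOutside 𝒜 m x := by
  constructor
  · rintro ⟨z, hz, rfl⟩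
    exact hz.1
  · intro hx
    have h := hx
    obtain ⟨c, rfl, hc⟩ := h
    exact ⟨⟨_, hC c⟩, ⟨hx, hm _ hx⟩, rfl⟩

/-- The form ring `(R, Λ)` with scalar `lam` is graded: the involution preserves degrees, `lam` has
degree zero, and `Λ` contains the homogeneous components of its elements. -/
structure IsGradedForm (lam : R) (Λ : AddSubgroup R) : Prop where
  star_mem : ∀ i, ∀ a ∈ 𝒜 i, star a ∈ 𝒜 i
  lam_mem : lam ∈ 𝒜 0
  component_mem : ∀ a ∈ Λ, ∀ i, (DirectSum.decompose 𝒜 a i : R) ∈ Λ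

end Graded

end GradedLG

open GradedLG

/-! Let `K` be the commutative ring `formScalars Λ` of central self-adjoint scalars that multiply
`Λ` into itself. Each `k` in `K` gives an endomorphism of the graded form ring, the dilation
multiplying `R_i` by `k ^ i`. Write `α(k)` for the image of `α`. Then `α(1) = α`, while `α(0) = 1`
because `α` is trivial modulo `R_+`. The scalars `z` such that `a ≡ b` modulo `z` forces `α(a)
α(b)⁻¹` to be elementary form an ideal of `K` (`dilationIdeal`). If it contains `1`, taking `a = 1`
and `b = 0` shows that `α` is elementary.

Were the part of this ideal in degree zero proper, it would lie in a maximal ideal `P` of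
`gradedScalars`. Since `C(R_0)` is integral over `gradedScalars`, some maximal ideal `m` of `C(R_0)`
lies over `P` (`exists_maximal_over`). It therefore suffices to find, for every `m`, an element `z *
star z` of the ideal with `z` in `S_m` (`exists_dilate_mul_inv_mem`); it lies outside `m`, hence
outside `P`.

For this local statement all base points `b` are treated at once. Over the ring of polynomials in
`X` whose coefficients are functions `K → R`, let `φ_w` multiply `R_i` by `(b + w X) ^ i`, with `b`
the identity function of `K`. As `S_m` has degree zero, `φ_w` extends to the localizations. The
extensions tend to that of `φ_0` as `w` becomes divisible by more and more norms from `S_m`.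
Conjugation by an elementary matrix is continuous for the topology defined by the groups with
parameters divisible by a given norm (`conjContinuous_of_mem`; here `n ≥ 3` enters). So, for `w`
divisible enough, `φ_w(α) φ_0(α)⁻¹` becomes elementary with parameters free of denominators
(`eventually_glMap_mul_inv_mem`) and agrees up to `u`-torsion with an elementary matrix `η` over the
polynomial ring.

The torsion is harmless: if `u p = 0` for a polynomial `p`, then `p(u v) = p(0)`. Substituting `u v`
for `X` therefore gives an equality over `R` itself (`dilate_mul_inv_mem_of_torsion`). -/

namespace GradedLG

open Matrix

set_option linter.unusedSectionVars false

/-! ### Elementary matrices in block form and the groups they generate. -/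

section Blocks

variable {C : Type*} [Ring C] [StarRing C] {n : ℕ}

/-- The block matrix `1, 0, X, 1` as a unit. -/
def low (X : Matrix (Fin n) (Fin n) C) : (Matrix (Fin n ⊕ Fin n) (Fin n ⊕ Fin n) C)ˣ where
  val := fromBlocks 1 0 X 1
  inv := fromBlocks 1 0 (-X) 1
  val_inv := by simp [fromBlocks_multiply]
  inv_val := by simp [fromBlocks_multiply]

/-- The block matrix `1, X, 0, 1` as a unit. -/
def up (X : Matrix (Fin n) (Fin n) C) : (Matrix (Fin n ⊕ Fin n) (Fin n ⊕ Fin n) C)ˣ where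
  val := fromBlocks 1 X 0 1
  inv := fromBlocks 1 (-X) 0 1
  val_inv := by simp [fromBlocks_multiply]
  inv_val := by simp [fromBlocks_multiply]

/-- The matrix whose row `p` is `v`, with the entry `(p, p)` replaced by `0`, and whose other rows
vanish. -/
def rowMat (p : Fin n) (v : Fin n → C) : Matrix (Fin n) (Fin n) C :=
  Matrix.of fun k l => if k = p ∧ l ≠ p then v l else 0

theorem rowMat_apply (p : Fin n) (v : Fin n → C) (k l : Fin n) :
    rowMat p v k l = if k = p ∧ l ≠ p then v l else 0 := rfl

theorem rowMat_add (p : Fin n) (v w : Fin n → C) :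
    rowMat p (v + w) = rowMat p v + rowMat p w := by
  ext k l; simp only [rowMat_apply, Matrix.add_apply, Pi.add_apply]; split_ifs <;> simp

theorem rowMat_zero (p : Fin n) : rowMat p (0 : Fin n → C) = 0 := by
  ext k l; simp [rowMat_apply]

theorem rowMat_mul_rowMat (p : Fin n) (v w : Fin n → C) : rowMat p v * rowMat p w = 0 := by
  ext k l
  simp only [Matrix.mul_apply, rowMat_apply, Matrix.zero_apply]
  refine Finset.sum_eq_zero fun x _ => ?_
  by_cases hx : x = p <;> simp [hx]

theorem rowMat_single {p m : Fin n} (h : p ≠ m) (a : C) :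
    rowMat p (Pi.single m a) = Matrix.single p m a := by
  ext k l
  simp only [rowMat_apply, Matrix.single_apply, Pi.single_apply]
  grind

theorem star_rowMat_mul (p : Fin n) (v w : Fin n → C) :
    (rowMat p v)ᴴ * (rowMat p w)ᴴ = 0 := by
  rw [← conjTranspose_mul, rowMat_mul_rowMat, conjTranspose_zero]

/-- The block diagonal elementary unit with upper block `1 + rowMat p v`. -/
def rowEps (p : Fin n) (v : Fin n → C) : (Matrix (Fin n ⊕ Fin n) (Fin n ⊕ Fin n) C)ˣ where
  val := fromBlocks (1 + rowMat p v) 0 0 (1 - (rowMat p v)ᴴ)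
  inv := fromBlocks (1 - rowMat p v) 0 0 (1 + (rowMat p v)ᴴ)
  val_inv := by
    simp [fromBlocks_multiply, add_mul, sub_mul, mul_add, mul_sub, rowMat_mul_rowMat,
      star_rowMat_mul]
  inv_val := by
    simp [fromBlocks_multiply, add_mul, sub_mul, mul_add, mul_sub, rowMat_mul_rowMat,
      star_rowMat_mul]

@[simp] theorem low_val (X : Matrix (Fin n) (Fin n) C) : (low X).val = fromBlocks 1 0 X 1 := rfl
@[simp] theorem up_val (X : Matrix (Fin n) (Fin n) C) : (up X).val = fromBlocks 1 X 0 1 := rfl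
@[simp] theorem rowEps_val (p : Fin n) (v : Fin n → C) :
    (rowEps p v).val = fromBlocks (1 + rowMat p v) 0 0 (1 - (rowMat p v)ᴴ) := rfl

theorem low_add (X Y : Matrix (Fin n) (Fin n) C) : low (X + Y) = low X * low Y := by
  ext1; simp [fromBlocks_multiply]

theorem up_add (X Y : Matrix (Fin n) (Fin n) C) : up (X + Y) = up X * up Y := by
  ext1; simp [fromBlocks_multiply, add_comm]

theorem low_zero : low (0 : Matrix (Fin n) (Fin n) C) = 1 := by
  ext1; simp

theorem up_zero : up (0 : Matrix (Fin n) (Fin n) C) = 1 := by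
  ext1; simp

theorem low_neg (X : Matrix (Fin n) (Fin n) C) : low (-X) = (low X)⁻¹ := by
  rw [eq_inv_iff_mul_eq_one, ← low_add, neg_add_cancel, low_zero]

theorem up_neg (X : Matrix (Fin n) (Fin n) C) : up (-X) = (up X)⁻¹ := by
  rw [eq_inv_iff_mul_eq_one, ← up_add, neg_add_cancel, up_zero]

theorem rowEps_add (p : Fin n) (v w : Fin n → C) :
    rowEps p (v + w) = rowEps p v * rowEps p w := by
  ext1
  simp only [rowEps_val, Units.val_mul, fromBlocks_multiply, rowMat_add, conjTranspose_add]
  congr 1 <;> simp [mul_add, add_mul, mul_sub, sub_mul, rowMat_mul_rowMat, star_rowMat_mul]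
  all_goals abel

theorem rowEps_zero (p : Fin n) : rowEps p (0 : Fin n → C) = 1 := by
  ext1; simp [rowMat_zero]

theorem rowEps_neg (p : Fin n) (v : Fin n → C) : rowEps p (-v) = (rowEps p v)⁻¹ := by
  rw [eq_inv_iff_mul_eq_one, ← rowEps_add, neg_add_cancel, rowEps_zero]

theorem rowEps_single_val {i j : Fin n} (h : i ≠ j) (a : C) :
    (rowEps i (Pi.single j a)).val = qeps n i j a := by
  simp [rowMat_single h, qeps]

/-- The lower left block of `ql n lam i j a`. -/
def shortMat (lam : C) (i j : Fin n) (a : C) : Matrix (Fin n) (Fin n) C :=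
  Matrix.single i j a - Matrix.single j i (lam * star a)

theorem low_shortMat (lam : C) (i j : Fin n) (a : C) :
    (low (shortMat lam i j a)).val = ql n lam i j a := rfl

theorem up_shortMat (lam : C) (i j : Fin n) (a : C) :
    (up (shortMat (star lam) i j a)).val = qr n lam i j a := rfl

theorem low_single (i : Fin n) (a : C) : (low (Matrix.single i i a)).val = qlDiag n i a := rfl

theorem up_single (i : Fin n) (a : C) : (up (Matrix.single i i a)).val = qrDiag n i a := rfl

theorem shortMat_neg (lam : C) (i j : Fin n) (a : C) :
    shortMat lam i j (-a) = -shortMat lam i j a := by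
  simp [shortMat, Matrix.single_neg, sub_eq_add_neg, add_comm]

/-- The generators of the elementary quadratic group with short root parameters in `J` and long root
parameters in `Γ`. -/
def elemGens (n : ℕ) (lam : C) (J Γ : Set C) :
    Set (Matrix (Fin n ⊕ Fin n) (Fin n ⊕ Fin n) C)ˣ :=
  {g | (∃ (i j : Fin n) (a : C), i ≠ j ∧ a ∈ J ∧
          (g = rowEps i (Pi.single j a) ∨ g = up (shortMat (star lam) i j a) ∨
            g = low (shortMat lam i j a))) ∨
       (∃ (i : Fin n), ∃ a ∈ Γ, g = up (Matrix.single i i (star a)) ∨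
          g = low (Matrix.single i i a))}

/-- The elementary quadratic group with short root parameters in `J` and long root parameters in
`Γ`. -/
def elemGroup (n : ℕ) (lam : C) (J Γ : Set C) :
    Subgroup (Matrix (Fin n ⊕ Fin n) (Fin n ⊕ Fin n) C)ˣ :=
  Subgroup.closure (elemGens n lam J Γ)

theorem EQ_eq_elemGroup (lam : C) (Λ : AddSubgroup C) :
    EQ n lam Λ = elemGroup n lam Set.univ (Λ : Set C) := by
  unfold EQ elemGroup elemGens
  congr 1
  ext g
  simp only [Set.mem_ofPred_eq, Set.mem_univ, true_and, SetLike.mem_coe, Units.ext_iff,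
    low_shortMat, up_shortMat, up_single, low_single]
  refine or_congr (exists_congr fun i => exists_congr fun j => exists_congr fun a => ?_) Iff.rfl
  refine and_congr_right fun h => ?_
  rw [rowEps_single_val h]

theorem elemGroup_mono (lam : C) {J J' Γ Γ' : Set C} (hJ : J ⊆ J') (hΓ : Γ ⊆ Γ') :
    elemGroup n lam J Γ ≤ elemGroup n lam J' Γ' := by
  refine Subgroup.closure_mono ?_
  rintro g (⟨i, j, a, hij, ha, h⟩ | ⟨i, a, ha, h⟩)
  · exact Or.inl ⟨i, j, a, hij, hJ ha, h⟩
  · exact Or.inr ⟨i, a, hΓ ha, h⟩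

section Mem

variable {lam : C} {J Γ : Set C}

theorem rowEps_single_mem {i j : Fin n} (h : i ≠ j) {a : C} (ha : a ∈ J) :
    rowEps i (Pi.single j a) ∈ elemGroup n lam J Γ :=
  Subgroup.subset_closure (Or.inl ⟨i, j, a, h, ha, Or.inl rfl⟩)

theorem up_shortMat_mem {i j : Fin n} (h : i ≠ j) {a : C} (ha : a ∈ J) :
    up (shortMat (star lam) i j a) ∈ elemGroup n lam J Γ :=
  Subgroup.subset_closure (Or.inl ⟨i, j, a, h, ha, Or.inr (Or.inl rfl)⟩)

theorem low_shortMat_mem {i j : Fin n} (h : i ≠ j) {a : C} (ha : a ∈ J) :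
    low (shortMat lam i j a) ∈ elemGroup n lam J Γ :=
  Subgroup.subset_closure (Or.inl ⟨i, j, a, h, ha, Or.inr (Or.inr rfl)⟩)

theorem up_single_mem (i : Fin n) {a : C} (ha : star a ∈ Γ) :
    up (Matrix.single i i a) ∈ elemGroup n lam J Γ :=
  Subgroup.subset_closure (Or.inr ⟨i, star a, ha, Or.inl (by rw [star_star])⟩)

theorem low_single_mem (i : Fin n) {a : C} (ha : a ∈ Γ) :
    low (Matrix.single i i a) ∈ elemGroup n lam J Γ :=
  Subgroup.subset_closure (Or.inr ⟨i, a, ha, Or.inr rfl⟩)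

/-- A homomorphism from `Fin n → C` into a group takes values in a subgroup as soon as the vectors
with one nonzero coordinate are mapped there. -/
theorem map_vector_mem {G : Type*} [Group G] (f : (Fin n → C) → G)
    (hadd : ∀ v w, f (v + w) = f v * f w) (H : Subgroup G) (v : Fin n → C)
    (hv : ∀ m, f (Pi.single m (v m)) ∈ H) : f v ∈ H := by
  have h0 : f 0 = 1 := by
    have := hadd 0 0
    rwa [add_zero, left_eq_mul] at this
  have key : ∀ s : Finset (Fin n), f (∑ m ∈ s, Pi.single m (v m)) ∈ H := by
    intro s
    induction s using Finset.induction_on with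
    | empty => simp [h0]
    | insert a s ha ih => rw [Finset.sum_insert ha, hadd]; exact H.mul_mem (hv a) ih
  simpa [Finset.univ_sum_single] using key Finset.univ

theorem rowEps_mem (p : Fin n) (v : Fin n → C) (hv : ∀ m, m ≠ p → v m ∈ J) :
    rowEps p v ∈ elemGroup n lam J Γ := by
  refine map_vector_mem (rowEps p) (rowEps_add p) _ v fun m => ?_
  by_cases hm : p = m
  · have : rowEps p (Pi.single m (v m)) = 1 := by
      have h0 : rowMat p (Pi.single m (v m)) = 0 := by
        ext k l; simp only [rowMat_apply, Pi.single_apply, Matrix.zero_apply]; grind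
      ext1; simp [h0]
    rw [this]; exact Subgroup.one_mem _
  · exact rowEps_single_mem hm (hv m (Ne.symm hm))

/-- The matrix with row `j` equal to `v`, entry `(j, j)` equal to `0`, and with column `j`
determined by skew-hermitian symmetry with respect to `lam`. -/
def crossMat (lam : C) (j : Fin n) (v : Fin n → C) : Matrix (Fin n) (Fin n) C :=
  rowMat j v - (lam • rowMat j fun m => star (v m) )ᵀ

theorem crossMat_apply (lam : C) (j : Fin n) (v : Fin n → C) (k l : Fin n) :
    crossMat lam j v k l = if k = j then (if l = j then 0 else v l) else
      (if l = j then -(lam * star (v k)) else 0) := by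
  simp only [crossMat, rowMat_apply, Matrix.sub_apply, Matrix.transpose_apply, Matrix.smul_apply,
    smul_eq_mul]
  split_ifs <;> grind

theorem low_crossMat_mem (j : Fin n) (v : Fin n → C) (hv : ∀ m, m ≠ j → v m ∈ J) :
    low (crossMat lam j v) ∈ elemGroup n lam J Γ := by
  refine map_vector_mem (fun v => low (crossMat lam j v)) (fun v w => ?_) _ v fun m => ?_
  · rw [← low_add]
    congr 1
    ext k l
    simp only [crossMat_apply, Matrix.add_apply, Pi.add_apply, star_add, mul_add, neg_add]
    split_ifs <;> simp
  · by_cases hm : j = m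
    · have : crossMat lam j (Pi.single m (v m)) = 0 := by
        ext k l
        subst hm
        by_cases hk : k = j <;> by_cases hl : l = j <;>
          simp [crossMat_apply, hk, hl]
      simp only [this, low_zero]
      exact Subgroup.one_mem _
    · have : crossMat lam j (Pi.single m (v m)) = shortMat lam j m (v m) := by
        have hs : (fun k => star ((Pi.single m (v m) : Fin n → C) k)) =
            Pi.single m (star (v m)) := by
          ext k; by_cases hk : k = m
          · subst hk; simp
          · simp [hk]
        rw [crossMat, hs, rowMat_single hm, rowMat_single hm, shortMat, Matrix.smul_single,
          Matrix.transpose_single, smul_eq_mul]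
      simp only [this]
      exact low_shortMat_mem hm (hv m (Ne.symm hm))

end Mem

/-! ### Symmetry between upper and lower triangular blocks. -/

section Swap

/-- The block permutation matrix exchanging the two summands. -/
def swapUnit (n : ℕ) (C : Type*) [Ring C] : (Matrix (Fin n ⊕ Fin n) (Fin n ⊕ Fin n) C)ˣ where
  val := fromBlocks 0 1 1 0
  inv := fromBlocks 0 1 1 0
  val_inv := by simp [fromBlocks_multiply]
  inv_val := by simp [fromBlocks_multiply]

theorem swapUnit_mul_self : swapUnit n C * swapUnit n C = 1 := by
  ext1; simp [swapUnit, fromBlocks_multiply]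

theorem swapUnit_inv : (swapUnit n C)⁻¹ = swapUnit n C :=
  inv_eq_of_mul_eq_one_left swapUnit_mul_self

/-- Conjugation by `swapUnit`. -/
def swapConj (n : ℕ) (C : Type*) [Ring C] :
    (Matrix (Fin n ⊕ Fin n) (Fin n ⊕ Fin n) C)ˣ →* (Matrix (Fin n ⊕ Fin n) (Fin n ⊕ Fin n) C)ˣ :=
  (MulAut.conj (swapUnit n C)).toMonoidHom

theorem swapConj_apply (g : (Matrix (Fin n ⊕ Fin n) (Fin n ⊕ Fin n) C)ˣ) :
    swapConj n C g = swapUnit n C * g * swapUnit n C := by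
  simp [swapConj, swapUnit_inv]

theorem swapConj_swapConj (g : (Matrix (Fin n ⊕ Fin n) (Fin n ⊕ Fin n) C)ˣ) :
    swapConj n C (swapConj n C g) = g := by
  simp only [swapConj_apply]
  calc _ = (swapUnit n C * swapUnit n C) * g * (swapUnit n C * swapUnit n C) := by group
    _ = g := by simp [swapUnit_mul_self]

theorem swapConj_low (X : Matrix (Fin n) (Fin n) C) : swapConj n C (low X) = up X := by
  rw [swapConj_apply]; ext1; simp [swapUnit, fromBlocks_multiply]

theorem swapConj_up (X : Matrix (Fin n) (Fin n) C) : swapConj n C (up X) = low X := by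
  rw [← swapConj_low, swapConj_swapConj]

theorem swapConj_rowEps {i j : Fin n} (h : i ≠ j) (a : C) :
    swapConj n C (rowEps i (Pi.single j a)) = rowEps j (Pi.single i (-star a)) := by
  rw [swapConj_apply]; ext1
  simp only [Units.val_mul, rowEps_val, rowMat_single h, rowMat_single h.symm, swapUnit,
    fromBlocks_multiply]
  congr 1 <;> simp [Matrix.single_neg, sub_eq_add_neg]

/-- The swap turns upper blocks into lower ones, so the form ring is replaced by its opposite, with
scalar `star lam` and conjugate long root parameters. This lets every statement about `up` be
deduced from the one about `low`. -/
theorem swapConj_mem_aux {lam : C} {J Γ : Set C} (hJ : ∀ a ∈ J, -star a ∈ J)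
    {g : (Matrix (Fin n ⊕ Fin n) (Fin n ⊕ Fin n) C)ˣ}
    (hg : g ∈ elemGroup n lam J Γ) :
    swapConj n C g ∈ elemGroup n (star lam) J (star ⁻¹' Γ) := by
  suffices h : elemGroup n lam J Γ ≤
      (elemGroup n (star lam) J (star ⁻¹' Γ)).comap (swapConj n C) from h hg
  refine (Subgroup.closure_le _).2 ?_
  rintro g (⟨i, j, a, hij, ha, rfl | rfl | rfl⟩ | ⟨i, a, ha, rfl | rfl⟩) <;>
    simp only [Subgroup.coe_comap, Set.mem_preimage, SetLike.mem_coe]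
  · rw [swapConj_rowEps hij]; exact rowEps_single_mem hij.symm (hJ a ha)
  · rw [swapConj_up]; exact low_shortMat_mem hij ha
  · rw [swapConj_low]
    have := up_shortMat_mem (lam := star lam) (Γ := star ⁻¹' Γ) hij ha
    rwa [star_star] at this
  · rw [swapConj_up]; exact low_single_mem i (by simpa using ha)
  · rw [swapConj_low]; exact up_single_mem i (by simpa using ha)

theorem swapConj_mem_iff {lam : C} {J Γ : Set C} (hJ : ∀ a ∈ J, -star a ∈ J)
    {g : (Matrix (Fin n ⊕ Fin n) (Fin n ⊕ Fin n) C)ˣ} :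
    swapConj n C g ∈ elemGroup n (star lam) J (star ⁻¹' Γ) ↔ g ∈ elemGroup n lam J Γ := by
  refine ⟨fun h => ?_, swapConj_mem_aux hJ⟩
  have := swapConj_mem_aux hJ h
  rwa [swapConj_swapConj, star_star, ← Set.preimage_comp,
    show (star ∘ star : C → C) = id from funext star_star, Set.preimage_id] at this

end Swap

end Blocks

/-! ### Conjugation and commutator relations between root elements. -/

section Relations

variable {C : Type*} [Ring C] [StarRing C] {n : ℕ}

/-- With `P = single i j a`, the skew symmetry of `X` makes column `j` of `X * P` the skew adjoint
of row `j` of `Pᴴ * X`. Together they form a cross through `(j, j)`, where the three diagonal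
contributions are collected separately. -/
theorem crossMat_eq {lam : C} {X : Matrix (Fin n) (Fin n) C}
    (hX : ∀ k l, X k l = -(lam * star (X l k))) {i j : Fin n} (a : C) :
    crossMat lam j (fun m => star a * X i m) +
        Matrix.single j j (star a * X i j + X j i * a + star a * X i i * a) =
      Matrix.single j i (star a) * X + X * Matrix.single i j a +
        Matrix.single j i (star a) * X * Matrix.single i j a := by
  rw [Matrix.single_mul_mul_single]
  have h1 : ∀ k, -(lam * star (star a * X i k)) = X k i * a := by
    intro k
    rw [hX k i, star_mul, star_star, ← mul_assoc, neg_mul]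
  ext k l
  simp only [crossMat_apply, Matrix.add_apply, h1]
  by_cases hk : k = j
  · subst hk
    by_cases hl : l = k
    · subst hl
      simp [add_assoc]
    · simp [hl, Ne.symm hl]
  · by_cases hl : l = j
    · subst hl
      simp [hk, Ne.symm hk]
    · simp [hk, hl, Ne.symm hk]

/-- Conjugating `low X` by the inverse of the block diagonal matrix replaces `X` by `(1 + Pᴴ) X (1 +
P)` with `P = single i j a`. The difference from `X` is the matrix decomposed in `crossMat_eq`. -/
theorem low_conj_rowEps {lam : C} {X : Matrix (Fin n) (Fin n) C}
    (hX : ∀ k l, X k l = -(lam * star (X l k))) {i j : Fin n} (hij : i ≠ j) (a : C) :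
    low X * rowEps i (Pi.single j a) * (low X)⁻¹ = rowEps i (Pi.single j a) *
      (low (crossMat lam j fun m => star a * X i m) *
        low (Matrix.single j j (star a * X i j + X j i * a + star a * X i i * a))) := by
  rw [mul_inv_eq_iff_eq_mul, ← low_add, crossMat_eq hX, mul_assoc, ← low_add]
  ext1
  have hP : Matrix.single j i (star a) * Matrix.single j i (star a) = 0 :=
    Matrix.single_mul_single_of_ne _ _ _ _ hij _
  simp only [Units.val_mul, low_val, rowEps_val, rowMat_single hij, fromBlocks_multiply,
    Matrix.conjTranspose_single]
  congr 1 <;> simp only [one_mul, mul_one, zero_mul, mul_zero, add_zero, zero_add]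
  simp only [mul_add, sub_mul, one_mul, mul_one, ← mul_assoc, hP, zero_mul]
  abel

variable {X : Matrix (Fin n) (Fin n) C} {p : Fin n}

theorem single_mul_of_row_eq_zero (hr : ∀ l, X p l = 0) (k : Fin n) (a : C) :
    Matrix.single k p a * X = 0 := by
  ext i j
  by_cases hi : i = k
  · subst hi; simp [hr]
  · simp [Matrix.single_mul_apply_of_ne _ _ _ _ _ hi]

theorem mul_single_of_col_eq_zero (hr : ∀ l, X l p = 0) (k : Fin n) (a : C) :
    X * Matrix.single p k a = 0 := by
  ext i j
  by_cases hi : j = k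
  · subst hi; simp [hr]
  · simp [Matrix.mul_single_apply_of_ne _ _ _ _ _ hi]

theorem low_conj_up_single (hr : ∀ l, X p l = 0) (hr' : ∀ l, X l p = 0) (a : C) :
    low X * up (Matrix.single p p a) * (low X)⁻¹ = up (Matrix.single p p a) := by
  rw [mul_inv_eq_iff_eq_mul]
  ext1
  simp [fromBlocks_multiply, single_mul_of_row_eq_zero hr, mul_single_of_col_eq_zero hr']

/-- Write the upper block as `U - V`, with `U` in column `p` and `V` in row `p`. Row and column `p`
of `X` vanish, so `U X` and `X V` are zero. What survives is `V X`, a row giving a block diagonal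
factor, and `V X U`, concentrated at `(p, p)`. -/
theorem low_conj_up_shortMat {lam : C} (hc : ∀ x, lam * x = x * lam)
    (hX : ∀ k l, X k l = -(lam * star (X l k)))
    (hr : ∀ l, X p l = 0) (hr' : ∀ l, X l p = 0) (k : Fin n) (a : C) :
    low X * up (shortMat (star lam) k p a) * (low X)⁻¹ =
      up (shortMat (star lam) k p a) *
        up (Matrix.single p p (star lam * star a * X k k * a)) *
        rowEps p (fun m => star lam * star a * X k m) := by
  have hR : rowMat p (fun m => star lam * star a * X k m) =
      Matrix.single p k (star lam * star a) * X := by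
    ext i j
    by_cases hi : i = p
    · subst hi
      by_cases hj : j = i
      · subst hj; simp [rowMat_apply, hr']
      · simp [rowMat_apply, hj]
    · simp [rowMat_apply, hi, Matrix.single_mul_apply_of_ne _ _ _ _ _ hi]
  have hR' : (rowMat p (fun m => star lam * star a * X k m))ᴴ = -(X * Matrix.single k p a) := by
    ext i j
    rw [Matrix.conjTranspose_apply, hR]
    by_cases hj : j = p
    · subst hj
      simp only [Matrix.single_mul_apply_same, star_mul, star_star, Matrix.neg_apply,
        Matrix.mul_single_apply_same]
      rw [hX i k, neg_mul, neg_neg, ← hc a, ← mul_assoc, hc]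
    · simp [Matrix.single_mul_apply_of_ne _ _ _ _ _ hj, Matrix.mul_single_apply_of_ne _ _ _ _ _ hj]
  have h1 : Matrix.single k p a * X = 0 := single_mul_of_row_eq_zero hr k a
  have h2 : X * Matrix.single p k (star lam * star a) = 0 := mul_single_of_col_eq_zero hr' k _
  have hD : Matrix.single p p (star lam * star a * X k k * a) =
      Matrix.single p k (star lam * star a) * X * Matrix.single k p a := by
    rw [Matrix.single_mul_mul_single]
  rw [mul_inv_eq_iff_eq_mul, ← up_add, hD]
  ext1
  simp only [Units.val_mul, low_val, up_val, rowEps_val, hR', shortMat, fromBlocks_multiply]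
  rw [hR]
  generalize Matrix.single k p a = U at *
  generalize Matrix.single p k (star lam * star a) = V at *
  have h3 : ∀ Z, U * (X * Z) = 0 := fun Z => by rw [← mul_assoc, h1, zero_mul]
  have h4 : ∀ Z, X * (V * Z) = 0 := fun Z => by rw [← mul_assoc, h2, zero_mul]
  congr 1 <;>
    simp only [mul_add, add_mul, mul_sub, sub_mul, one_mul, mul_one, zero_mul, mul_zero, add_zero,
      zero_add, sub_neg_eq_add, mul_assoc, h1, h2, h3]
  all_goals abel

/-- This reaches upper positions avoiding `p` from root elements whose conjugates by `low X` are
already known. -/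
theorem up_shortMat_eq_commutator {mu s : C} (hss : star s = s)
    {k l p : Fin n} (hk : k ≠ p) (hl : l ≠ p) (c : C) :
    up (shortMat mu k l (s * c)) = rowEps k (Pi.single p s) * up (shortMat mu p l c) *
      (rowEps k (Pi.single p s))⁻¹ * (up (shortMat mu p l c))⁻¹ := by
  rw [eq_mul_inv_iff_mul_eq, eq_mul_inv_iff_mul_eq, ← up_add]
  ext1
  simp only [Units.val_mul, up_val, rowEps_val, rowMat_single hk, shortMat, fromBlocks_multiply,
    Matrix.conjTranspose_single]
  congr 1 <;>
    simp only [mul_add, add_mul, mul_sub, sub_mul, one_mul, mul_one, zero_mul, mul_zero, add_zero,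
      zero_add, Matrix.single_mul_single_same,
      Matrix.single_mul_single_of_ne _ _ _ _ hk, Matrix.single_mul_single_of_ne _ _ _ _ hl,
      Matrix.single_mul_single_of_ne _ _ _ _ hl.symm, star_mul, hss, sub_zero, mul_assoc]
  abel

/-- The long root element at `k` is obtained from the one at `p`, at the cost of a factor `s * s` in
its parameter. -/
theorem rowEps_conj_up_single {mu s : C} (hs : ∀ x, s * x = x * s) (hss : star s = s)
    {k p : Fin n} (hk : k ≠ p) {c : C} (hcc : c = -(mu * star c)) :
    rowEps k (Pi.single p s) * up (Matrix.single p p c) * (rowEps k (Pi.single p s))⁻¹ =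
      up (Matrix.single p p c) * up (shortMat mu k p (s * c)) *
        up (Matrix.single k k (s * (s * c))) := by
  have h1 : mu * (star c * s) = -(c * s) := by
    rw [← mul_assoc, ← neg_eq_iff_eq_neg, ← neg_mul, ← hcc]
  have h2 : s * (s * c) = s * (c * s) := by rw [hs c]
  have h3 : Matrix.single p k (-(c * s)) = -Matrix.single p k (c * s) := by
    ext i j; simp only [Matrix.single_apply, Matrix.neg_apply]; split_ifs <;> simp
  rw [mul_inv_eq_iff_eq_mul, ← up_add, ← up_add]
  ext1
  simp only [Units.val_mul, up_val, rowEps_val, rowMat_single hk, shortMat, fromBlocks_multiply,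
    Matrix.conjTranspose_single]
  congr 1 <;>
    simp only [mul_add, add_mul, mul_sub, sub_mul, one_mul, mul_one, zero_mul, mul_zero, add_zero,
      zero_add, Matrix.single_mul_single_same,
      Matrix.single_mul_single_of_ne _ _ _ _ hk,
      star_mul, hss, mul_assoc, h1, h2, h3, neg_mul, neg_zero]
  abel

end Relations

/-! ### Form rings inside a larger ring, and conjugation by a lower block with a zero row. -/

section Lattice

variable {C : Type*} [Ring C] [StarRing C] {n : ℕ}

theorem exists_center_eq {s : C} (hs : ∀ x, s * x = x * s) : ∃ z : Subring.center C, s = z :=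
  ⟨⟨s, Subring.mem_center_iff.2 fun x => (hs x).symm⟩, rfl⟩

theorem center_mul_eq_smul (z : Subring.center C) (x : C) : (z : C) * x = z • x := rfl

theorem mul_center_eq_smul (z : Subring.center C) (x : C) : x * (z : C) = z • x :=
  Subring.mem_center_iff.1 z.2 x

/-- A form ring `(B, Γ)` inside the ring `C`, together with a multiplicative set `T` of central
self-adjoint elements acting on it. -/
structure FormLattice (lam : C) (B : Subring C) (Γ : AddSubgroup C) (T : Submonoid C) : Prop where
  lam_central : ∀ x, lam * x = x * lam
  lam_mul_star : lam * star lam = 1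
  lam_mem : lam ∈ B
  star_mem : ∀ b ∈ B, star b ∈ B
  le : ∀ a ∈ Γ, a ∈ B
  min_le : ∀ b ∈ B, b - lam * star b ∈ Γ
  le_max : ∀ a ∈ Γ, a = -(lam * star a)
  conj_mem : ∀ b ∈ B, ∀ a ∈ Γ, star b * a * b ∈ Γ
  central : ∀ t ∈ T, ∀ x, t * x = x * t
  star_eq : ∀ t ∈ T, star t = t
  mem : ∀ t ∈ T, t ∈ B
  mul_mem : ∀ t ∈ T, ∀ a ∈ Γ, t * a ∈ Γ

variable (n) in
/-- The elementary group of the form ring `(B, Γ)` scaled by `s`. -/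
def scaledGroup (lam : C) (B : Subring C) (Γ : AddSubgroup C) (s : C) :
    Subgroup (Matrix (Fin n ⊕ Fin n) (Fin n ⊕ Fin n) C)ˣ :=
  elemGroup n lam ((s * ·) '' (B : Set C)) ((s * ·) '' (Γ : Set C))

namespace FormLattice

variable {lam : C} {B : Subring C} {Γ : AddSubgroup C} {T : Submonoid C}

theorem star_mul_lam (h : FormLattice lam B Γ T) : star lam * lam = 1 := by
  rw [← h.lam_central, h.lam_mul_star]

theorem star_lam_central (h : FormLattice lam B Γ T) (x : C) : star lam * x = x * star lam := by
  have := congrArg star (h.lam_central (star x))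
  simpa using this.symm

/-- These are the data obtained after exchanging upper and lower blocks. -/
theorem opposite (h : FormLattice lam B Γ T) :
    FormLattice (star lam) B (Γ.comap (starAddEquiv : C ≃+ C).toAddMonoidHom) T where
  lam_central := h.star_lam_central
  lam_mul_star := by rw [star_star, h.star_mul_lam]
  lam_mem := h.star_mem _ h.lam_mem
  star_mem := h.star_mem
  le a ha := by simpa using h.star_mem _ (h.le _ ha)
  min_le b hb := by
    have := h.min_le _ (h.star_mem b hb)
    simpa [h.lam_central] using this
  le_max a ha := by
    have := congrArg star (h.le_max _ ha)
    simpa [← h.star_lam_central] using this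
  conj_mem b hb a ha := by
    have := h.conj_mem b hb _ ha
    simpa [mul_assoc] using this
  central := h.central
  star_eq := h.star_eq
  mem := h.mem
  mul_mem t ht a ha := by
    have := h.mul_mem t ht _ ha
    simpa [h.star_eq t ht, ← h.central t ht] using this

theorem mem_scaledGroup_swap (h : FormLattice lam B Γ T) {s : C} (hs : s ∈ T)
    {g : (Matrix (Fin n ⊕ Fin n) (Fin n ⊕ Fin n) C)ˣ} :
    swapConj n C g ∈ scaledGroup n (star lam) B
        (Γ.comap (starAddEquiv : C ≃+ C).toAddMonoidHom) s ↔ g ∈ scaledGroup n lam B Γ s := by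
  rw [scaledGroup, scaledGroup, ← swapConj_mem_iff (lam := lam)]
  · suffices hh : ((s * ·) '' (Γ.comap (starAddEquiv : C ≃+ C).toAddMonoidHom : Set C)) =
      (star ⁻¹' ((s * ·) '' (Γ : Set C)) : Set C) by rw [hh]
    ext x
    constructor
    · rintro ⟨y, hy, rfl⟩
      exact ⟨star y, hy, by simp [h.star_eq s hs, h.central s hs]⟩
    · rintro ⟨y, hy, hx⟩
      refine ⟨star y, by simpa using hy, ?_⟩
      have := congrArg star hx
      simpa [h.star_eq s hs, ← h.central s hs] using this
  · rintro _ ⟨b, hb, rfl⟩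
    exact ⟨-star b, B.neg_mem (h.star_mem b hb), by simp [h.star_eq s hs, h.central s hs]⟩

/-- The parameters of `c`-multiples: `a * c * b` for scaled `b`. -/
theorem exists_scaled (h : FormLattice lam B Γ T) {s t x b c : C} (hs : s ∈ T) (ht : t ∈ T)
    (hx : t * x ∈ B) (hb : b ∈ B) (hc : c ∈ B) :
    c * star (s * t * b) * x ∈ ((s * ·) '' (B : Set C)) := by
  refine ⟨c * star b * (t * x), B.mul_mem (B.mul_mem hc (h.star_mem b hb)) hx, ?_⟩
  simp only [star_mul, h.star_eq s hs, h.star_eq t ht]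
  obtain ⟨zs, hzs⟩ := exists_center_eq (h.central s hs)
  obtain ⟨zt, hzt⟩ := exists_center_eq (h.central t ht)
  simp only [hzs, hzt, center_mul_eq_smul, mul_center_eq_smul, smul_mul_assoc,
    mul_smul_comm, mul_assoc, smul_comm zs zt]

variable {X : Matrix (Fin n) (Fin n) C} {p : Fin n} {s t : C}

/-- The factor `t` clears the denominators of `X` and `s` is kept as the scale. The two mixed terms
of the long root entry combine to `s * (y - lam * star y)`, which lies in the scaled `Γ` by
`min_le`. The quadratic term carries `s` and `t` twice, which is enough for `conj_mem`. -/
theorem low_conj_rowEps_mem (h : FormLattice lam B Γ T) (hs : s ∈ T) (ht : t ∈ T)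
    (hX : ∀ k l, X k l = -(lam * star (X l k)))
    (hB : ∀ k l, t * X k l ∈ B) (hΓ : ∀ k, t * X k k ∈ Γ) {i j : Fin n} (hij : i ≠ j) {b : C}
    (hb : b ∈ B) :
    low X * rowEps i (Pi.single j (s * t * b)) * (low X)⁻¹ ∈ scaledGroup n lam B Γ s := by
  have hv : ∀ m, star (s * t * b) * X i m ∈ ((s * ·) '' (B : Set C)) := fun m => by
    simpa using h.exists_scaled hs ht (hB i m) hb B.one_mem
  rw [low_conj_rowEps hX hij]
  refine Subgroup.mul_mem _ (rowEps_single_mem hij ⟨t * b, B.mul_mem (h.mem t ht) hb, ?_⟩)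
    (Subgroup.mul_mem _ (low_crossMat_mem j _ fun m _ => hv m) (low_single_mem j ?_))
  · simp [mul_assoc]
  · obtain ⟨y, hy, hy'⟩ := hv j
    refine ⟨(y - lam * star y) + s * (t * (star b * (t * X i i) * b)), Γ.add_mem (h.min_le y hy)
      (h.mul_mem s hs _ (h.mul_mem t ht _ (h.conj_mem b hb _ (hΓ i)))), ?_⟩
    have h1 : X j i * (s * t * b) = -(lam * star (star (s * t * b) * X i j)) := by
      rw [hX j i, star_mul, star_star, ← mul_assoc lam, neg_mul]
    simp only at hy'
    rw [h1, ← hy']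
    simp only [star_mul, h.star_eq s hs, h.star_eq t ht, mul_add, mul_sub, ← sub_eq_add_neg]
    congr 1
    · rw [← h.central s hs (star y)]
      congr 1
      rw [← mul_assoc, ← mul_assoc, h.central s hs lam]
    · obtain ⟨zs, hzs⟩ := exists_center_eq (h.central s hs)
      obtain ⟨zt, hzt⟩ := exists_center_eq (h.central t ht)
      simp only [hzs, hzt, center_mul_eq_smul, mul_center_eq_smul, smul_mul_assoc,
        mul_smul_comm, mul_assoc, smul_comm zs zt]

theorem low_conj_up_shortMat_mem (h : FormLattice lam B Γ T) (hs : s ∈ T) (ht : t ∈ T)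
    (hX : ∀ k l, X k l = -(lam * star (X l k)))
    (hB : ∀ k l, t * X k l ∈ B) (hΓ : ∀ k, t * X k k ∈ Γ)
    (hr : ∀ l, X p l = 0) (hr' : ∀ l, X l p = 0) {k : Fin n} (hk : k ≠ p) {b : C} (hb : b ∈ B) :
    low X * up (shortMat (star lam) k p (s * t * b)) * (low X)⁻¹ ∈ scaledGroup n lam B Γ s := by
  rw [low_conj_up_shortMat h.lam_central hX hr hr']
  refine Subgroup.mul_mem _ (Subgroup.mul_mem _ (up_shortMat_mem hk
    ⟨t * b, B.mul_mem (h.mem t ht) hb, ?_⟩) (up_single_mem p ?_)) (rowEps_mem p _ fun m _ => ?_)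
  · simp [mul_assoc]
  · refine ⟨-(s * (t * (star b * (t * X k k) * b))), Γ.neg_mem
      (h.mul_mem s hs _ (h.mul_mem t ht _ (h.conj_mem b hb _ (hΓ k)))), ?_⟩
    have h1 : star (X k k) * lam = -X k k := by
      rw [← h.lam_central, eq_neg_iff_add_eq_zero]
      nth_rw 2 [hX k k]
      simp
    have h2 : star (star lam * star (s * t * b) * X k k * (s * t * b)) =
        star (s * t * b) * (star (X k k) * lam) * (s * t * b) := by
      simp only [star_mul, star_star, mul_assoc]
      rw [h.lam_central]
      simp only [mul_assoc]
    rw [h2, h1]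
    simp only [star_mul, h.star_eq s hs, h.star_eq t ht, mul_neg, neg_mul, neg_inj]
    obtain ⟨zs, hzs⟩ := exists_center_eq (h.central s hs)
    obtain ⟨zt, hzt⟩ := exists_center_eq (h.central t ht)
    simp only [hzs, hzt, center_mul_eq_smul, mul_center_eq_smul, smul_mul_assoc,
      mul_smul_comm, mul_assoc, smul_comm zs zt]
  · exact h.exists_scaled hs ht (hB k m) hb (h.star_mem _ h.lam_mem)

/-- The vanishing row `p` makes the conjugates of the upper root elements meeting `p` explicit. The
other upper root elements are products of these with block diagonal ones, and lower root elements
commute with `low X`. -/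
theorem low_conj_mem (h : FormLattice lam B Γ T) (hs : s ∈ T) (ht : t ∈ T)
    (hX : ∀ k l, X k l = -(lam * star (X l k)))
    (hB : ∀ k l, t * X k l ∈ B) (hΓ : ∀ k, t * X k k ∈ Γ)
    (hr : ∀ l, X p l = 0) :
    ∃ s' ∈ T, scaledGroup n lam B Γ s' ≤
      (scaledGroup n lam B Γ s).comap (MulAut.conj (low X)).toMonoidHom := by
  have hr' : ∀ l, X l p = 0 := fun l => by rw [hX, hr]; simp
  set u := s * t with hu
  have hu' : u ∈ T := T.mul_mem hs ht
  have huB := h.mem u hu'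
  have hJ : ∀ b ∈ B, u * b ∈ ((s * ·) '' (B : Set C)) := fun b hb =>
    ⟨t * b, B.mul_mem (h.mem t ht) hb, by simp [hu, mul_assoc]⟩
  have hG : ∀ b ∈ Γ, u * b ∈ ((s * ·) '' (Γ : Set C)) := fun b hb =>
    ⟨t * b, h.mul_mem t ht _ hb, by simp [hu, mul_assoc]⟩
  have hmul : ∀ g g', low X * g * (low X)⁻¹ ∈ scaledGroup n lam B Γ s →
      low X * g' * (low X)⁻¹ ∈ scaledGroup n lam B Γ s →
      low X * (g * g') * (low X)⁻¹ ∈ scaledGroup n lam B Γ s := fun g g' hg hg' => by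
    have := Subgroup.mul_mem _ hg hg'
    simpa [mul_assoc] using this
  have hinv : ∀ g, low X * g * (low X)⁻¹ ∈ scaledGroup n lam B Γ s →
      low X * g⁻¹ * (low X)⁻¹ ∈ scaledGroup n lam B Γ s := fun g hg => by
    have := Subgroup.inv_mem _ hg
    simpa [mul_assoc] using this
  have heps : ∀ i j, i ≠ j → ∀ b ∈ B,
      low X * rowEps i (Pi.single j (u * b)) * (low X)⁻¹ ∈ scaledGroup n lam B Γ s :=
    fun i j hij b hb => h.low_conj_rowEps_mem hs ht hX hB hΓ hij hb
  have hupl : ∀ k, k ≠ p → ∀ b ∈ B,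
      low X * up (shortMat (star lam) k p (u * b)) * (low X)⁻¹ ∈ scaledGroup n lam B Γ s :=
    fun k hk b hb => h.low_conj_up_shortMat_mem hs ht hX hB hΓ hr hr' hk hb
  have hupr : ∀ k, k ≠ p → ∀ b ∈ B,
      low X * up (shortMat (star lam) p k (u * b)) * (low X)⁻¹ ∈ scaledGroup n lam B Γ s := by
    intro k hk b hb
    -- An upper short root element at `(p, k)` is also one at `(k, p)`, with parameter changed by
    -- the skew symmetry.
    have := hupl k hk (-(star lam * star b))
      (B.neg_mem (B.mul_mem (h.star_mem _ h.lam_mem) (h.star_mem _ hb)))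
    have hh : shortMat (star lam) k p (u * -(star lam * star b)) =
        shortMat (star lam) p k (u * b) := by
      have e1 : star lam * star (u * -(star lam * star b)) = -(u * b) := by
        simp only [star_mul, star_neg, star_star, h.star_eq u hu', mul_neg, neg_inj]
        rw [h.star_lam_central, mul_assoc, mul_assoc, ← h.star_lam_central u,
          ← mul_assoc lam, h.lam_mul_star, one_mul, h.central u hu']
      have e2 : u * -(star lam * star b) = -(star lam * star (u * b)) := by
        rw [star_mul, h.star_eq u hu', mul_neg, h.central u hu', mul_assoc]
      unfold shortMat
      rw [e1, e2]
      ext x y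
      simp only [Matrix.sub_apply, Matrix.single_apply]
      split_ifs <;> simp [sub_eq_add_neg, add_comm]
    rwa [hh] at this
  have hupp : ∀ a ∈ Γ, low X * up (Matrix.single p p (u * star a)) * (low X)⁻¹ ∈
      scaledGroup n lam B Γ s := fun a ha => by
    rw [low_conj_up_single hr hr']
    refine up_single_mem p ?_
    rw [star_mul, star_star, h.star_eq u hu', ← h.central u hu']
    exact hG a ha
  -- Three factors `u` are needed for a long root at `i ≠ p`: `rowEps_conj_up_single` with `s = u`
  -- uses two, and the long root parameter at `p` must itself be a multiple of `u`.
  refine ⟨u * (u * u), T.mul_mem hu' (T.mul_mem hu' hu'), (Subgroup.closure_le _).2 ?_⟩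
  have hu1 : u * 1 = u := mul_one u
  rintro g (⟨i, j, _, hij, ⟨b, hb, rfl⟩, rfl | rfl | rfl⟩ | ⟨i, _, ⟨a, ha, rfl⟩, rfl | rfl⟩) <;>
    simp only [Subgroup.coe_comap, Set.mem_preimage, SetLike.mem_coe, MulEquiv.coe_toMonoidHom,
      MulAut.conj_apply, mul_assoc u]
  · exact heps i j hij _ (B.mul_mem huB (B.mul_mem huB hb))
  · have hb' := B.mul_mem huB (B.mul_mem huB hb)
    by_cases hi : i = p
    · subst hi; exact hupr j hij.symm _ hb'
    by_cases hj : j = p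
    · subst hj; exact hupl i hij _ hb'
    rw [up_shortMat_eq_commutator (h.star_eq u hu') hi hj]
    have e := heps i p hi 1 B.one_mem
    rw [hu1] at e
    have f := hupr j hj _ (B.mul_mem huB hb)
    exact hmul _ _ (hmul _ _ (hmul _ _ e f) (hinv _ e)) (hinv _ f)
  · rw [← low_add, ← low_neg, ← low_add, add_comm X, add_neg_cancel_right]
    exact low_shortMat_mem hij (hJ _ (B.mul_mem huB (B.mul_mem huB hb)))
  · have hcc : star a = -(star lam * star (star a)) := by
      have := congrArg star (h.le_max a ha)
      simpa [← h.star_lam_central] using this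
    have hst : star (u * (u * (u * a))) = u * (u * (u * star a)) := by
      obtain ⟨z, hz⟩ := exists_center_eq (h.central u hu')
      simp only [star_mul, h.star_eq u hu']
      simp only [hz, center_mul_eq_smul, mul_center_eq_smul]
    rw [hst]
    by_cases hi : i = p
    · subst hi
      have := hupp (u * (u * a)) (h.mul_mem u hu' _ (h.mul_mem u hu' a ha))
      have hst' : u * star (u * (u * a)) = u * (u * (u * star a)) := by
        obtain ⟨z, hz⟩ := exists_center_eq (h.central u hu')
        simp only [star_mul, h.star_eq u hu']
        simp only [hz, center_mul_eq_smul, mul_center_eq_smul]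
      rwa [hst'] at this
    have hcu : u * star a = -(star lam * star (u * star a)) := by
      rw [star_mul, star_star, h.star_eq u hu']
      nth_rw 1 [hcc]
      rw [star_star, mul_neg, h.central u hu', mul_assoc]
    have key := rowEps_conj_up_single (h.central u hu') (h.star_eq u hu') hi hcu
    have e := heps i p hi 1 B.one_mem
    rw [hu1] at e
    have f := hupp a ha
    have g := hupl i hi _ (B.mul_mem huB (h.star_mem _ (h.le a ha)))
    -- The relation is solved for the long root element at `i`; all other factors have known
    -- conjugates.
    rw [mul_assoc (up _), ← inv_mul_eq_iff_eq_mul, ← inv_mul_eq_iff_eq_mul] at key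
    rw [← key]
    exact hmul _ _ (hinv _ g) (hmul _ _ (hinv _ f) (hmul _ _ (hmul _ _ e f) (hinv _ e)))
  · rw [← low_add, ← low_neg, ← low_add, add_comm X, add_neg_cancel_right]
    exact low_single_mem i (hG _ (h.mul_mem u hu' _ (h.mul_mem u hu' _ ha)))

end FormLattice

end Lattice

/-! ### Continuity of conjugation by elementary matrices. -/

section Commensurate

variable {C : Type*} [Ring C] [StarRing C] {n : ℕ}

theorem shortMat_skew {lam : C} (hl : lam * star lam = 1) (hc : ∀ x, lam * x = x * lam)
    {i j : Fin n} (hij : i ≠ j) (a : C) (k l : Fin n) :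
    shortMat lam i j a k l = -(lam * star (shortMat lam i j a l k)) := by
  have h1 : lam * (a * star lam) = a := by rw [← mul_assoc, hc, mul_assoc, hl, mul_one]
  simp only [shortMat, Matrix.sub_apply, Matrix.single_apply]
  by_cases h : i = k ∧ j = l
  · obtain ⟨rfl, rfl⟩ := h
    simp [hij, hij.symm, h1]
  · by_cases h' : i = l ∧ j = k
    · obtain ⟨rfl, rfl⟩ := h'
      simp [hij, hij.symm]
    · have h2 : ¬ (j = l ∧ i = k) := fun e => h ⟨e.2, e.1⟩
      have h3 : ¬ (j = k ∧ i = l) := fun e => h' ⟨e.2, e.1⟩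
      simp [h, h', h2, h3]

theorem single_skew {lam : C} (i : Fin n) {a : C} (ha : a = -(lam * star a)) (k l : Fin n) :
    Matrix.single i i a k l = -(lam * star (Matrix.single i i a l k)) := by
  simp only [Matrix.single_apply]
  by_cases h : i = k ∧ i = l
  · obtain ⟨rfl, rfl⟩ := h
    simpa using ha
  · have h' : ¬ (i = l ∧ i = k) := fun e => h ⟨e.2, e.1⟩
    simp [h, h']

theorem exists_ne_ne (hn : 3 ≤ n) (i j : Fin n) : ∃ p : Fin n, p ≠ i ∧ p ≠ j := by
  have : ({i, j} : Finset (Fin n)).card < Fintype.card (Fin n) := by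
    rw [Fintype.card_fin]; exact lt_of_le_of_lt (Finset.card_le_two) hn
  obtain ⟨p, hp⟩ := Finset.exists_mem_notMem_of_card_lt_card
    (s := {i, j}) (t := Finset.univ) (by simpa using this)
  exact ⟨p, by simpa using hp.2⟩

/-- A short root element of the block diagonal type is a commutator. -/
theorem rowEps_single_eq_commutator {lam : C} (hl : lam * star lam = 1)
    (hc : ∀ x, lam * x = x * lam) {i j k : Fin n} (hki : k ≠ i) (hkj : k ≠ j) (hij : i ≠ j)
    (a : C) :
    rowEps i (Pi.single j a) = (up (shortMat (star lam) k i 1))⁻¹ *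
      (low (shortMat lam k j (lam * a)) * up (shortMat (star lam) k i 1) *
        (low (shortMat lam k j (lam * a)))⁻¹) := by
  have hl' : star lam * lam = 1 := by rw [← hc, hl]
  rw [low_conj_up_shortMat hc (fun x y => shortMat_skew hl hc hkj _ x y)]
  · have h1 : shortMat lam k j (lam * a) k k = 0 := by
      simp [shortMat, hkj.symm]
    have h2 : (fun m => star lam * star (1 : C) * shortMat lam k j (lam * a) k m) =
        Pi.single j a := by
      ext m
      by_cases hm : m = j
      · subst hm
        simp [shortMat, hkj, hkj.symm, ← mul_assoc, hl']
      · simp [shortMat, hkj.symm, Ne.symm hm, hm]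
    rw [h1, h2]
    simp [up_zero]
  · intro l; simp [shortMat, hki, hij.symm]
  · intro l; simp [shortMat, hki, hij.symm]

namespace FormLattice

variable {lam : C} {B : Subring C} {Γ : AddSubgroup C} {T : Submonoid C}

/-- Conjugation by `γ` is continuous for the topology given by the groups `scaledGroup`. -/
def ConjContinuous (lam : C) (B : Subring C) (Γ : AddSubgroup C) (T : Submonoid C)
    (γ : (Matrix (Fin n ⊕ Fin n) (Fin n ⊕ Fin n) C)ˣ) : Prop :=
  ∀ s ∈ T, ∃ s' ∈ T, scaledGroup n lam B Γ s' ≤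
    (scaledGroup n lam B Γ s).comap (MulAut.conj γ).toMonoidHom

theorem ConjContinuous.mul {γ δ : (Matrix (Fin n ⊕ Fin n) (Fin n ⊕ Fin n) C)ˣ}
    (hγ : ConjContinuous lam B Γ T γ) (hδ : ConjContinuous lam B Γ T δ) :
    ConjContinuous lam B Γ T (γ * δ) := by
  intro s hs
  obtain ⟨s₁, hs₁, h₁⟩ := hγ s hs
  obtain ⟨s₂, hs₂, h₂⟩ := hδ s₁ hs₁
  refine ⟨s₂, hs₂, fun g hg => ?_⟩
  have := h₁ (h₂ hg)
  simpa [mul_assoc] using this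

theorem ConjContinuous.one :
    ConjContinuous lam B Γ T (1 : (Matrix (Fin n ⊕ Fin n) (Fin n ⊕ Fin n) C)ˣ) :=
  fun s hs => ⟨s, hs, fun g hg => by simpa using hg⟩

/-- The elements of `C` that have a multiple by an element of `T` in `Γ`. -/
def fractions (T : Submonoid C) (Γ : AddSubgroup C) : Set C := {a | ∃ t ∈ T, t * a ∈ Γ}

theorem exists_common_den (h : FormLattice lam B Γ T) (hden : ∀ c, ∃ t ∈ T, t * c ∈ B)
    (X : Matrix (Fin n) (Fin n) C) (hΓ : ∀ k, X k k ∈ fractions T Γ) :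
    ∃ t ∈ T, (∀ k l, t * X k l ∈ B) ∧ ∀ k, t * X k k ∈ Γ := by
  choose d hd hdB using hden
  choose e he heΓ using hΓ
  have key : ∀ (f : Fin n × Fin n → C) (A : Set C) (_ : ∀ t ∈ T, ∀ a ∈ A, t * a ∈ A)
      (S : Finset (Fin n × Fin n)) (_ : ∀ i, ∃ t ∈ T, t * f i ∈ A),
      ∃ t ∈ T, ∀ i ∈ S, t * f i ∈ A := by
    intro f A hA S hf
    induction S using Finset.induction_on with
    | empty => exact ⟨1, T.one_mem, by simp⟩
    | insert i S _ ih =>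
      obtain ⟨t, ht, htS⟩ := ih
      obtain ⟨t', ht', hti⟩ := hf i
      refine ⟨t * t', T.mul_mem ht ht', fun j hj => ?_⟩
      rcases Finset.mem_insert.1 hj with rfl | hj
      · rw [mul_assoc]; exact hA t ht _ hti
      · rw [h.central t ht, mul_assoc]; exact hA t' ht' _ (htS j hj)
  obtain ⟨t, ht, htB⟩ := key (fun i => X i.1 i.2) B (fun t ht a ha => B.mul_mem (h.mem t ht) ha)
    Finset.univ fun i => ⟨_, hd _, hdB _⟩
  obtain ⟨t', ht', htΓ⟩ := key (fun i => X i.1 i.1) Γ (fun t ht a ha => h.mul_mem t ht a ha)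
    Finset.univ fun i => ⟨_, he _, heΓ _⟩
  refine ⟨t * t', T.mul_mem ht ht', fun k l => ?_, fun k => ?_⟩
  · rw [h.central t ht, mul_assoc]
    exact B.mul_mem (h.mem t' ht') (htB (k, l) (Finset.mem_univ _))
  · rw [mul_assoc]
    exact h.mul_mem t ht _ (htΓ (k, k) (Finset.mem_univ _))

theorem conjContinuous_low (h : FormLattice lam B Γ T) (hden : ∀ c, ∃ t ∈ T, t * c ∈ B)
    {X : Matrix (Fin n) (Fin n) C} (hX : ∀ k l, X k l = -(lam * star (X l k)))
    (hΓ : ∀ k, X k k ∈ fractions T Γ) {p : Fin n} (hr : ∀ l, X p l = 0) :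
    ConjContinuous lam B Γ T (low X) := by
  obtain ⟨t, ht, htB, htΓ⟩ := h.exists_common_den hden X hΓ
  exact fun s hs => h.low_conj_mem hs ht hX htB htΓ hr

/-- The swap carries the scaled groups of the form ring to those of its opposite, so continuity
transfers in both directions. -/
theorem conjContinuous_of_swap (h : FormLattice lam B Γ T)
    {γ : (Matrix (Fin n ⊕ Fin n) (Fin n ⊕ Fin n) C)ˣ}
    (hγ : ConjContinuous (star lam) B (Γ.comap (starAddEquiv : C ≃+ C).toAddMonoidHom) T
      (swapConj n C γ)) : ConjContinuous lam B Γ T γ := by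
  intro s hs
  obtain ⟨s', hs', hle⟩ := hγ s hs
  refine ⟨s', hs', fun g hg => ?_⟩
  have := hle ((h.mem_scaledGroup_swap hs').2 hg)
  simp only [Subgroup.mem_comap, MulEquiv.coe_toMonoidHom, MulAut.conj_apply] at this ⊢
  rwa [← map_inv, ← map_mul, ← map_mul, h.mem_scaledGroup_swap hs] at this

theorem conjContinuous_up (h : FormLattice lam B Γ T) (hden : ∀ c, ∃ t ∈ T, t * c ∈ B)
    {X : Matrix (Fin n) (Fin n) C} (hX : ∀ k l, X k l = -(star lam * star (X l k)))
    (hΓ : ∀ k, star (X k k) ∈ fractions T Γ) {p : Fin n} (hr : ∀ l, X p l = 0) :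
    ConjContinuous lam B Γ T (up X) := by
  refine h.conjContinuous_of_swap ?_
  rw [swapConj_up]
  refine h.opposite.conjContinuous_low hden hX (fun k => ?_) hr
  obtain ⟨t, ht, hta⟩ := hΓ k
  exact ⟨t, ht, by simpa [h.star_eq t ht, h.central t ht] using hta⟩

/-- The nontrivial block of an upper or lower generator involves at most two indices, so for `n ≥ 3`
it has a zero row and the previous continuity statements apply. Block diagonal generators are
products of such upper and lower ones. Continuity is stable under products. -/
theorem conjContinuous_of_mem (h : FormLattice lam B Γ T) (hn : 3 ≤ n)
    (hden : ∀ c, ∃ t ∈ T, t * c ∈ B) (hunit : ∀ t ∈ T, IsUnit t)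
    {γ : (Matrix (Fin n ⊕ Fin n) (Fin n ⊕ Fin n) C)ˣ}
    (hγ : γ ∈ elemGroup n lam Set.univ (fractions T Γ)) : ConjContinuous lam B Γ T γ := by
  have h0 : (0 : C) ∈ fractions T Γ := ⟨1, T.one_mem, by simp⟩
  have hneg : ∀ a ∈ fractions T Γ, -a ∈ fractions T Γ := by
    rintro a ⟨t, ht, hta⟩
    exact ⟨t, ht, by simpa using hta⟩
  have hskew : ∀ a ∈ fractions T Γ, a = -(lam * star a) := by
    rintro a ⟨t, ht, hta⟩
    refine (hunit t ht).mul_left_cancel ?_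
    have := h.le_max _ hta
    rw [star_mul, h.star_eq t ht, ← h.central t ht] at this
    rw [mul_neg, ← mul_assoc, h.central t ht lam, mul_assoc]
    exact this
  have hopp := h.opposite
  have hlow : ∀ i j : Fin n, i ≠ j → ∀ a, ConjContinuous lam B Γ T (low (shortMat lam i j a)) := by
    intro i j hij a
    obtain ⟨p, hpi, hpj⟩ := exists_ne_ne hn i j
    refine h.conjContinuous_low hden (shortMat_skew h.lam_mul_star h.lam_central hij a)
      (fun k => ?_) (p := p) fun l => by simp [shortMat, hpi.symm, hpj.symm]
    have : shortMat lam i j a k k = 0 := by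
      simp only [shortMat, Matrix.sub_apply, Matrix.single_apply]
      have h1 : ¬ (i = k ∧ j = k) := fun e => hij (e.1.trans e.2.symm)
      have h2 : ¬ (j = k ∧ i = k) := fun e => hij (e.2.trans e.1.symm)
      simp [h1, h2]
    rwa [this]
  have hup : ∀ i j : Fin n, i ≠ j → ∀ a, ConjContinuous lam B Γ T (up (shortMat (star lam) i j a)) := by
    intro i j hij a
    obtain ⟨p, hpi, hpj⟩ := exists_ne_ne hn i j
    refine h.conjContinuous_up hden (shortMat_skew hopp.lam_mul_star hopp.lam_central hij a)
      (fun k => ?_) (p := p) fun l => by simp [shortMat, hpi.symm, hpj.symm]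
    have : shortMat (star lam) i j a k k = 0 := by
      simp only [shortMat, Matrix.sub_apply, Matrix.single_apply]
      have h1 : ¬ (i = k ∧ j = k) := fun e => hij (e.1.trans e.2.symm)
      have h2 : ¬ (j = k ∧ i = k) := fun e => hij (e.2.trans e.1.symm)
      simp [h1, h2]
    rwa [this, star_zero]
  have hlow' : ∀ i : Fin n, ∀ a ∈ fractions T Γ, ConjContinuous lam B Γ T (low (Matrix.single i i a)) := by
    intro i a ha
    obtain ⟨p, hpi, -⟩ := exists_ne_ne hn i i
    refine h.conjContinuous_low hden (single_skew i (hskew a ha)) (fun k => ?_) (p := p)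
      fun l => by simp [hpi.symm]
    by_cases hk : i = k
    · subst hk; simpa using ha
    · simpa [hk] using h0
  have hup' : ∀ i : Fin n, ∀ a ∈ fractions T Γ,
      ConjContinuous lam B Γ T (up (Matrix.single i i (star a))) := by
    intro i a ha
    obtain ⟨p, hpi, -⟩ := exists_ne_ne hn i i
    have hs : star a = -(star lam * star (star a)) := by
      have := congrArg star (hskew a ha)
      simpa [← h.star_lam_central] using this
    refine h.conjContinuous_up hden (single_skew i hs) (fun k => ?_) (p := p)
      fun l => by simp [hpi.symm]
    by_cases hk : i = k
    · subst hk; simpa using ha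
    · simpa [hk] using h0
  have heps : ∀ i j : Fin n, i ≠ j → ∀ a, ConjContinuous lam B Γ T (rowEps i (Pi.single j a)) := by
    intro i j hij a
    obtain ⟨k, hki, hkj⟩ := exists_ne_ne hn i j
    rw [rowEps_single_eq_commutator h.lam_mul_star h.lam_central hki hkj hij, ← up_neg, ← low_neg,
      ← shortMat_neg, ← shortMat_neg]
    exact (hup _ _ hki _).mul (((hlow _ _ hkj _).mul (hup _ _ hki _)).mul (hlow _ _ hkj _))
  -- Continuity for `γ` alone does not formally give it for `γ⁻¹`, so both are carried through the
  -- induction.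
  suffices hh : ConjContinuous lam B Γ T γ ∧ ConjContinuous lam B Γ T γ⁻¹ from hh.1
  induction hγ using Subgroup.closure_induction with
  | mem g hg =>
    rcases hg with (⟨i, j, a, hij, -, rfl | rfl | rfl⟩ | ⟨i, a, ha, rfl | rfl⟩)
    · refine ⟨heps i j hij a, ?_⟩
      rw [← rowEps_neg, ← Pi.single_neg]
      exact heps i j hij _
    · refine ⟨hup i j hij a, ?_⟩
      rw [← up_neg, ← shortMat_neg]
      exact hup i j hij _
    · refine ⟨hlow i j hij a, ?_⟩
      rw [← low_neg, ← shortMat_neg]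
      exact hlow i j hij _
    · refine ⟨hup' i a ha, ?_⟩
      rw [← up_neg, Matrix.single_neg, ← star_neg]
      exact hup' i _ (hneg a ha)
    · refine ⟨hlow' i a ha, ?_⟩
      rw [← low_neg, Matrix.single_neg]
      exact hlow' i _ (hneg a ha)
  | one => exact ⟨.one, by simpa using ConjContinuous.one⟩
  | mul x y _ _ hx hy => exact ⟨hx.1.mul hy.1, by rw [_root_.mul_inv_rev]; exact hy.2.mul hx.2⟩
  | inv x _ hx => exact ⟨hx.2, by simpa using hx.1⟩

end FormLattice

end Commensurate

/-! ### Behaviour of elementary groups under ring homomorphisms. -/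

section Functoriality

variable {A : Type*} [Ring A] {C : Type*} [Ring C] {n : ℕ}

/-- The map induced by a ring homomorphism on general linear groups. -/
def glMap (n : ℕ) (f : A →+* C) :
    (Matrix (Fin n ⊕ Fin n) (Fin n ⊕ Fin n) A)ˣ →* (Matrix (Fin n ⊕ Fin n) (Fin n ⊕ Fin n) C)ˣ :=
  Units.map (f.mapMatrix : Matrix (Fin n ⊕ Fin n) (Fin n ⊕ Fin n) A →+*
    Matrix (Fin n ⊕ Fin n) (Fin n ⊕ Fin n) C).toMonoidHom

theorem glMap_val (f : A →+* C) (g : (Matrix (Fin n ⊕ Fin n) (Fin n ⊕ Fin n) A)ˣ) :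
    (glMap n f g).val = g.val.map f := rfl

theorem glMap_val_apply (f : A →+* C) (g : (Matrix (Fin n ⊕ Fin n) (Fin n ⊕ Fin n) A)ˣ)
    (i j : Fin n ⊕ Fin n) : (glMap n f g).val i j = f (g.val i j) := rfl

theorem glMap_comp {D : Type*} [Ring D] (g : C →+* D) (f : A →+* C)
    (x : (Matrix (Fin n ⊕ Fin n) (Fin n ⊕ Fin n) A)ˣ) :
    glMap n g (glMap n f x) = glMap n (g.comp f) x := by
  ext i j; rfl

theorem glMap_low (f : A →+* C) (X : Matrix (Fin n) (Fin n) A) :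
    glMap n f (low X) = low (X.map f) := by
  ext1; simp [glMap_val, Matrix.fromBlocks_map]

theorem glMap_up (f : A →+* C) (X : Matrix (Fin n) (Fin n) A) :
    glMap n f (up X) = up (X.map f) := by
  ext1; simp [glMap_val, Matrix.fromBlocks_map]

variable [StarRing A] [StarRing C]

theorem glMap_rowEps (f : A →+* C) (hf : ∀ a, f (star a) = star (f a)) (p : Fin n)
    (v : Fin n → A) : glMap n f (rowEps p v) = rowEps p (f ∘ v) := by
  have h1 : (rowMat p v).map f = rowMat p (f ∘ v) := by
    ext i j; simp only [Matrix.map_apply, rowMat_apply, Function.comp]; split_ifs <;> simp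
  have h2 : ((rowMat p v)ᴴ).map f = (rowMat p (f ∘ v))ᴴ := by
    ext i j; simp [← h1, hf]
  ext1
  simp only [glMap_val, rowEps_val, Matrix.fromBlocks_map, ← h2]
  congr 1
  · rw [← h1, Matrix.map_add _ (map_add f), Matrix.map_one _ (map_zero f) (map_one f)]
  · exact Matrix.map_zero _ (map_zero f)
  · exact Matrix.map_zero _ (map_zero f)
  · rw [Matrix.map_sub _ (map_sub f), Matrix.map_one _ (map_zero f) (map_one f)]

theorem map_pi_single (f : A →+* C) (j : Fin n) (a : A) :
    f ∘ (Pi.single j a : Fin n → A) = Pi.single j (f a) := by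
  ext m
  by_cases hm : m = j
  · subst hm; simp
  · simp [hm]

theorem shortMat_map (f : A →+* C) (hf : ∀ a, f (star a) = star (f a)) (lam : A) (i j : Fin n)
    (a : A) : (shortMat lam i j a).map f = shortMat (f lam) i j (f a) := by
  ext k l
  simp only [shortMat, Matrix.map_apply, Matrix.sub_apply, Matrix.single_apply, map_sub]
  congr 1 <;> split_ifs <;> simp [hf]

theorem single_sub_single {m : Type*} [DecidableEq m] (i j : m) (a b : A) :
    Matrix.single i j (a - b) = Matrix.single i j a - Matrix.single i j b := by
  ext k l
  simp only [Matrix.sub_apply, Matrix.single_apply]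
  split_ifs <;> simp

theorem single_map (f : A →+* C) (i : Fin n) (a : A) :
    (Matrix.single i i a).map f = Matrix.single i i (f a) := by
  ext k l
  simp only [Matrix.map_apply, Matrix.single_apply]
  split_ifs <;> simp

theorem elemGroup_le_comap (f : A →+* C) (hf : ∀ a, f (star a) = star (f a)) {lam : A} {mu : C}
    (hl : f lam = mu) {J Γ : Set A} {J' Γ' : Set C} (hJ : ∀ a ∈ J, f a ∈ J')
    (hΓ : ∀ a ∈ Γ, f a ∈ Γ') :
    elemGroup n lam J Γ ≤ (elemGroup n mu J' Γ').comap (glMap n f) := by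
  subst hl
  refine (Subgroup.closure_le _).2 ?_
  rintro g (⟨i, j, a, hij, ha, rfl | rfl | rfl⟩ | ⟨i, a, ha, rfl | rfl⟩) <;>
    simp only [Subgroup.coe_comap, Set.mem_preimage, SetLike.mem_coe]
  · rw [glMap_rowEps f hf, map_pi_single]; exact rowEps_single_mem hij (hJ a ha)
  · rw [glMap_up, shortMat_map f hf, hf]; exact up_shortMat_mem hij (hJ a ha)
  · rw [glMap_low, shortMat_map f hf]; exact low_shortMat_mem hij (hJ a ha)
  · rw [glMap_up, single_map, hf]
    exact up_single_mem i (by rw [star_star]; exact hΓ a ha)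
  · rw [glMap_low, single_map]; exact low_single_mem i (hΓ a ha)

theorem elemGroup_image_le_map (f : A →+* C) (hf : ∀ a, f (star a) = star (f a)) (lam : A)
    (J Γ : Set A) :
    elemGroup n (f lam) (f '' J) (f '' Γ) ≤ (elemGroup n lam J Γ).map (glMap n f) := by
  refine (Subgroup.closure_le _).2 ?_
  rintro g (⟨i, j, _, hij, ⟨a, ha, rfl⟩, rfl | rfl | rfl⟩ | ⟨i, _, ⟨a, ha, rfl⟩, rfl | rfl⟩)
  · exact ⟨_, rowEps_single_mem hij ha, by rw [glMap_rowEps f hf, map_pi_single]⟩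
  · exact ⟨_, up_shortMat_mem hij ha, by rw [glMap_up, shortMat_map f hf, hf]⟩
  · exact ⟨_, low_shortMat_mem hij ha, by rw [glMap_low, shortMat_map f hf]⟩
  · exact ⟨_, up_single_mem i (a := star a) (by rwa [star_star]),
      by rw [glMap_up, single_map, hf]⟩
  · exact ⟨_, low_single_mem i ha, by rw [glMap_low, single_map]⟩

end Functoriality

/-! ### Pointwise convergence of homomorphisms implies convergence on elementary matrices. -/

section Close

variable {D : Type*} [Ring D] [StarRing D] {C : Type*} [Ring C] [StarRing C] {n : ℕ}
  {lam : C} {B : Subring C} {Γ : AddSubgroup C} {T : Submonoid C}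

/-- If ring homomorphisms `f i` converge to `f₀` pointwise, then they converge to `f₀` on each
element of the elementary group. -/
theorem FormLattice.eventually_glMap_mul_inv_mem (h : FormLattice lam B Γ T) (hn : 3 ≤ n)
    (hden : ∀ c, ∃ t ∈ T, t * c ∈ B) (hunit : ∀ t ∈ T, IsUnit t)
    {I : Type*} (l : Filter I) (f : I → D →+* C) (f₀ : D →+* C)
    (hf : ∀ i a, f i (star a) = star (f i a)) (hf₀ : ∀ a, f₀ (star a) = star (f₀ a))
    {mu : D} (hmu : ∀ i, f i mu = lam) (hmu₀ : f₀ mu = lam) {Δ : Set D}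
    (hΔ : ∀ a ∈ Δ, f₀ a ∈ fractions T Γ)
    (hclose : ∀ s ∈ T, ∀ a, ∀ᶠ i in l, f i a - f₀ a ∈ (s * ·) '' (B : Set C))
    (hcloseΓ : ∀ s ∈ T, ∀ a ∈ Δ, ∀ᶠ i in l, f i a - f₀ a ∈ (s * ·) '' (Γ : Set C))
    {β : (Matrix (Fin n ⊕ Fin n) (Fin n ⊕ Fin n) D)ˣ} (hβ : β ∈ elemGroup n mu Set.univ Δ) :
    ∀ s ∈ T, ∀ᶠ i in l, glMap n (f i) β * (glMap n f₀ β)⁻¹ ∈ scaledGroup n lam B Γ s := by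
  have hcont : ∀ γ ∈ elemGroup n mu Set.univ Δ,
      FormLattice.ConjContinuous lam B Γ T (glMap n f₀ γ) := fun γ hγ =>
    h.conjContinuous_of_mem hn hden hunit
      (elemGroup_le_comap f₀ hf₀ hmu₀ (fun _ _ => Set.mem_univ _) hΔ hγ)
  induction hβ using Subgroup.closure_induction with
  | mem g hg =>
    intro s hs
    rcases hg with (⟨i, j, a, hij, -, rfl | rfl | rfl⟩ | ⟨i, a, ha, rfl | rfl⟩)
    · filter_upwards [hclose s hs a] with k hk
      rw [glMap_rowEps _ (hf k), glMap_rowEps _ hf₀, map_pi_single, map_pi_single, ← rowEps_neg,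
        ← rowEps_add, ← Pi.single_neg, ← Pi.single_add, ← sub_eq_add_neg]
      exact rowEps_single_mem hij hk
    · filter_upwards [hclose s hs a] with k hk
      have : shortMat (star lam) i j (f k a) + -shortMat (star lam) i j (f₀ a) =
          shortMat (star lam) i j (f k a - f₀ a) := by
        simp only [shortMat, star_sub, mul_sub, single_sub_single]; abel
      rw [glMap_up, glMap_up, shortMat_map _ (hf k), shortMat_map _ hf₀, ← up_neg, ← up_add,
        hf, hf₀, hmu, hmu₀, this]
      exact up_shortMat_mem hij hk
    · filter_upwards [hclose s hs a] with k hk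
      have : shortMat lam i j (f k a) + -shortMat lam i j (f₀ a) =
          shortMat lam i j (f k a - f₀ a) := by
        simp only [shortMat, star_sub, mul_sub, single_sub_single]; abel
      rw [glMap_low, glMap_low, shortMat_map _ (hf k), shortMat_map _ hf₀, ← low_neg, ← low_add,
        hmu, hmu₀, this]
      exact low_shortMat_mem hij hk
    · filter_upwards [hcloseΓ s hs a ha] with k hk
      rw [glMap_up, glMap_up, single_map, single_map, hf, hf₀, ← up_neg, ← up_add,
        ← sub_eq_add_neg, ← single_sub_single]
      exact up_single_mem i (by simpa using hk)
    · filter_upwards [hcloseΓ s hs a ha] with k hk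
      rw [glMap_low, glMap_low, single_map, single_map, ← low_neg, ← low_add,
        ← sub_eq_add_neg, ← single_sub_single]
      exact low_single_mem i hk
  | one => intro s _; simp
  | mul x y hx hy ihx ihy =>
    intro s hs
    -- With `f = f k`, the element `f(xy) f₀(xy)⁻¹` is `f(x) f₀(x)⁻¹` times the conjugate of `f(y)
    -- f₀(y)⁻¹` by `f₀(x)`. Continuity is needed only for the fixed matrix `f₀(x)`, which does not
    -- depend on the index of the family.
    obtain ⟨s', hs', hle⟩ := hcont x hx s hs
    filter_upwards [ihx s hs, ihy s' hs'] with k hxk hyk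
    have := Subgroup.mul_mem _ hxk (hle hyk)
    simpa [mul_assoc] using this
  | inv x hx ih =>
    intro s hs
    -- Here `f(x)⁻¹ f₀(x)` is the conjugate by `f₀(x)⁻¹` of the inverse of `f(x) f₀(x)⁻¹`.
    obtain ⟨s', hs', hle⟩ := hcont x⁻¹ (Subgroup.inv_mem _ hx) s hs
    filter_upwards [ih s' hs'] with k hk
    have := hle (Subgroup.inv_mem _ hk)
    simpa [mul_assoc] using this

end Close

/-! ### Scalars compatible with the involution and the form parameter. -/

theorem center_comm {B : Type*} [Ring B] (k : Subring.center B) (x : B) : (k : B) * x = x * k :=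
  (Subring.mem_center_iff.1 k.2 x).symm

section Scalars

variable {B : Type*} [Ring B] [StarRing B]

/-- The central self-adjoint elements that multiply `Λ` into itself. -/
def formScalars (Λ : AddSubgroup B) : Subring (Subring.center B) where
  carrier := {k | star (k : B) = k ∧ ∀ a ∈ Λ, (k : B) * a ∈ Λ}
  mul_mem' := by
    rintro k l ⟨hk, hk'⟩ ⟨hl, hl'⟩
    refine ⟨?_, fun a ha => ?_⟩
    · simp only [Subring.coe_mul, star_mul, hk, hl]
      exact Subring.mem_center_iff.1 k.2 _
    · rw [Subring.coe_mul, mul_assoc]; exact hk' _ (hl' a ha)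
  one_mem' := ⟨by simp, fun a ha => by simpa using ha⟩
  add_mem' := by
    rintro k l ⟨hk, hk'⟩ ⟨hl, hl'⟩
    refine ⟨by simp [hk, hl], fun a ha => ?_⟩
    rw [Subring.coe_add, add_mul]; exact Λ.add_mem (hk' a ha) (hl' a ha)
  zero_mem' := ⟨by simp, fun a ha => by simp⟩
  neg_mem' := by
    rintro k ⟨hk, hk'⟩
    refine ⟨by simp [hk], fun a ha => ?_⟩
    rw [Subring.coe_neg, neg_mul]; exact Λ.neg_mem (hk' a ha)

end Scalars

/-! ### Homomorphisms scaling the graded pieces by powers of a central element. -/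

section GradedScale

variable {R : Type*} [Ring R] (𝒜 : ℕ → AddSubgroup R) [GradedRing 𝒜]
variable {B : Type*} [Ring B]

/-- The ring homomorphism that sends `a ∈ R_i` to `f a * c ^ i`. -/
noncomputable def gscale (f : R →+* B) (c : Subring.center B) : R →+* B :=
  (DirectSum.toSemiring
    (fun i => (AddMonoidHom.mulRight ((c : B) ^ i)).comp (f.toAddMonoidHom.comp (𝒜 i).subtype))
    (by simp) (by
      intro i j a b
      have h : (c : B) ^ i * f b = f b * (c : B) ^ i := by
        have := center_comm (c ^ i) (f b)
        simpa using this
      change f ((a : R) * b) * (c : B) ^ (i + j) = f a * (c : B) ^ i * (f b * (c : B) ^ j)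
      rw [map_mul, pow_add, mul_assoc, mul_assoc, ← mul_assoc (_ ^ i), h, mul_assoc])).comp
  (DirectSum.decomposeRingEquiv 𝒜).toRingHom

theorem gscale_of_mem (f : R →+* B) (c : Subring.center B) {i : ℕ} {a : R} (ha : a ∈ 𝒜 i) :
    gscale 𝒜 f c a = f a * (c : B) ^ i := by
  have h : DirectSum.decomposeRingEquiv 𝒜 a = DirectSum.of (fun i => 𝒜 i) i ⟨a, ha⟩ :=
    DirectSum.decompose_of_mem 𝒜 ha
  unfold gscale
  rw [RingHom.comp_apply, RingEquiv.toRingHom_eq_coe, RingHom.coe_coe, h,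
    DirectSum.toSemiring_of]
  rfl

theorem graded_induction {P : R → Prop} (h0 : P 0) (hadd : ∀ a b, P a → P b → P (a + b))
    (hom : ∀ i, ∀ a ∈ 𝒜 i, P a) (a : R) : P a :=
  DirectSum.Decomposition.inductionOn 𝒜 h0 (fun {i} m => hom i m m.2) hadd a

theorem graded_induction_param [StarRing R] {lam : R} {Λ : AddSubgroup R}
    (hgr : IsGradedForm 𝒜 lam Λ) {P : R → Prop} (h0 : P 0)
    (hadd : ∀ a b, P a → P b → P (a + b))
    (hom : ∀ i, ∀ a ∈ 𝒜 i, a ∈ Λ → P a) {a : R} (ha : a ∈ Λ) : P a := by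
  classical
  rw [← DirectSum.sum_support_decompose 𝒜 a]
  refine Finset.sum_induction _ P hadd h0 fun i _ => ?_
  exact hom i _ (SetLike.coe_mem _) (hgr.component_mem a ha i)

theorem map_gscale {D : Type*} [Ring D] (h : B →+* D) (f : R →+* B) (c : Subring.center B)
    (d : Subring.center D) (hcd : h c = d) (a : R) :
    h (gscale 𝒜 f c a) = gscale 𝒜 (h.comp f) d a := by
  refine graded_induction 𝒜 (P := fun a => h (gscale 𝒜 f c a) = gscale 𝒜 (h.comp f) d a)
    (by simp) (fun a b ha hb => by simp [ha, hb]) (fun i a ha => ?_) a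
  rw [gscale_of_mem 𝒜 _ _ ha, gscale_of_mem 𝒜 _ _ ha, map_mul, map_pow, hcd]
  rfl

theorem gscale_id_one (a : R) : gscale 𝒜 (RingHom.id R) 1 a = a := by
  refine graded_induction 𝒜 (P := fun a => gscale 𝒜 (RingHom.id R) 1 a = a)
    (by simp) (fun a b ha hb => by simp [ha, hb]) (fun i a ha => ?_) a
  rw [gscale_of_mem 𝒜 _ _ ha]; simp

theorem gscale_zero (f : R →+* B) (a : R) : gscale 𝒜 f 0 a = f (GradedRing.proj 𝒜 0 a) := by
  refine graded_induction 𝒜 (P := fun a => gscale 𝒜 f 0 a = f (GradedRing.proj 𝒜 0 a))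
    (by simp) (fun a b ha hb => by simp only [map_add, ha, hb]) (fun i a ha => ?_) a
  rw [gscale_of_mem 𝒜 _ _ ha, GradedRing.proj_apply]
  by_cases hi : i = 0
  · subst hi
    rw [DirectSum.decompose_of_mem_same 𝒜 ha]; simp
  · rw [DirectSum.decompose_of_mem_ne 𝒜 ha hi]; simp [hi]

variable [StarRing R] [StarRing B] {lam : R} {Λ : AddSubgroup R} {Γ : AddSubgroup B}

theorem gscale_star (hgr : IsGradedForm 𝒜 lam Λ) (f : R →+* B)
    (hf : ∀ a, f (star a) = star (f a)) (c : Subring.center B) (hc : star (c : B) = c) (a : R) :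
    gscale 𝒜 f c (star a) = star (gscale 𝒜 f c a) := by
  refine graded_induction 𝒜 (P := fun a => gscale 𝒜 f c (star a) = star (gscale 𝒜 f c a))
    (by simp) (fun a b ha hb => by simp [ha, hb]) (fun i a ha => ?_) a
  rw [gscale_of_mem 𝒜 _ _ ha, gscale_of_mem 𝒜 _ _ (hgr.star_mem i a ha), star_mul, star_pow, hc, hf]
  simpa using (center_comm (c ^ i) (star (f a))).symm

/-- On degree `i` the difference is `c ^ i - d ^ i` times `f a`, and `c - d` divides `c ^ i - d ^
i`. The quotient is taken inside `formScalars Γ`, so that it also preserves the form parameter. -/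
theorem gscale_sub_gscale (f : R →+* B) (c d w : formScalars Γ)
    (hw : w ∣ c - d) {i : ℕ} {a : R} (ha : a ∈ 𝒜 i) :
    ∃ k : formScalars Γ, gscale 𝒜 f c.1 a - gscale 𝒜 f d.1 a = (w.1 : B) * ((k.1 : B) * f a) := by
  obtain ⟨k, hk⟩ := hw.trans (sub_dvd_pow_sub_pow c d i)
  refine ⟨k, ?_⟩
  have hk' : ((c.1 : B) ^ i - (d.1 : B) ^ i) = (w.1 : B) * (k.1 : B) := by
    have := congrArg (fun x : formScalars Γ => ((x : Subring.center B) : B)) hk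
    simpa using this
  rw [gscale_of_mem 𝒜 _ _ ha, gscale_of_mem 𝒜 _ _ ha, ← mul_sub, hk', ← mul_assoc,
    ← center_comm k.1, center_comm w.1, ← mul_assoc, ← center_comm w.1]

theorem exists_gscale_sub_gscale (f : R →+* B) (c d w : formScalars Γ)
    (hw : w ∣ c - d) (a : R) :
    ∃ b, gscale 𝒜 f c.1 a - gscale 𝒜 f d.1 a = (w.1 : B) * b := by
  refine graded_induction 𝒜
    (P := fun a => ∃ b, gscale 𝒜 f c.1 a - gscale 𝒜 f d.1 a = (w.1 : B) * b)
    ⟨0, by simp⟩ ?_ (fun i a ha => ?_) a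
  · rintro a b ⟨x, hx⟩ ⟨y, hy⟩
    exact ⟨x + y, by rw [map_add, map_add, add_sub_add_comm, hx, hy, mul_add]⟩
  · obtain ⟨k, hk⟩ := gscale_sub_gscale 𝒜 f c d w hw ha
    exact ⟨_, hk⟩

theorem exists_gscale_sub_gscale_param (hgr : IsGradedForm 𝒜 lam Λ) (f : R →+* B)
    (hfΛ : ∀ a ∈ Λ, f a ∈ Γ) (c d w : formScalars Γ)
    (hw : w ∣ c - d) {a : R} (ha : a ∈ Λ) :
    ∃ b ∈ Γ, gscale 𝒜 f c.1 a - gscale 𝒜 f d.1 a = (w.1 : B) * b := by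
  refine graded_induction_param 𝒜 hgr
    (P := fun a => ∃ b ∈ Γ, gscale 𝒜 f c.1 a - gscale 𝒜 f d.1 a = (w.1 : B) * b)
    ⟨0, Γ.zero_mem, by simp⟩ ?_ (fun i a ha haΛ => ?_) ha
  · rintro a b ⟨x, hx', hx⟩ ⟨y, hy', hy⟩
    exact ⟨x + y, Γ.add_mem hx' hy', by rw [map_add, map_add, add_sub_add_comm, hx, hy, mul_add]⟩
  · obtain ⟨k, hk⟩ := gscale_sub_gscale 𝒜 f c d w hw ha
    exact ⟨_, k.2.2 _ (hfΛ a haΛ), hk⟩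

theorem gscale_mem_param (hgr : IsGradedForm 𝒜 lam Λ) (f : R →+* B)
    (hfΛ : ∀ a ∈ Λ, f a ∈ Γ) (c : formScalars Γ) {a : R} (ha : a ∈ Λ) :
    gscale 𝒜 f c.1 a ∈ Γ := by
  refine graded_induction_param 𝒜 hgr (P := fun a => gscale 𝒜 f c.1 a ∈ Γ)
    (by simp) (fun a b ha hb => by rw [map_add]; exact Γ.add_mem ha hb) (fun i a ha haΛ => ?_) ha
  have := (c ^ i).2.2 _ (hfΛ a haΛ)
  rw [gscale_of_mem 𝒜 _ _ ha]
  rw [center_comm] at this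
  simpa using this

end GradedScale

/-! ### Polynomial and function rings as form rings. -/

section Poly

open Polynomial

variable {F : Type*} [Ring F] [StarRing F]

theorem coeff_unop_map_star (p : F[X]) (i : ℕ) :
    (MulOpposite.unop
      ((opRingEquiv F).symm (p.map (starRingEquiv : F ≃+* Fᵐᵒᵖ).toRingHom))).coeff i =
      star (p.coeff i) := by
  have h := coeff_opRingEquiv
    ((opRingEquiv F).symm (p.map (starRingEquiv : F ≃+* Fᵐᵒᵖ).toRingHom)) i
  rw [RingEquiv.apply_symm_apply, coeff_map] at h
  exact (congrArg MulOpposite.unop h).symm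

/-- The involution of `F[X]` acting on the coefficients. -/
noncomputable instance polyStarRing : StarRing F[X] where
  star p := MulOpposite.unop ((opRingEquiv F).symm (p.map (starRingEquiv : F ≃+* Fᵐᵒᵖ).toRingHom))
  star_involutive p := by
    ext i
    rw [coeff_unop_map_star, coeff_unop_map_star, star_star]
  star_mul p q := by simp
  star_add p q := by simp

theorem coeff_star (p : F[X]) (i : ℕ) : (star p).coeff i = star (p.coeff i) :=
  coeff_unop_map_star p i

theorem star_C (a : F) : star (C a : F[X]) = C (star a) := by
  ext i
  rw [coeff_star, coeff_C, coeff_C]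
  split_ifs <;> simp

theorem star_X : star (X : F[X]) = X := by
  ext i
  rw [coeff_star, coeff_X]
  split_ifs <;> simp

theorem X_mem_center : (X : F[X]) ∈ Subring.center F[X] :=
  Subring.mem_center_iff.2 fun p => (X_mul (p := p)).symm

theorem C_mem_center {a : F} (ha : a ∈ Subring.center F) : C a ∈ Subring.center F[X] :=
  Subring.mem_center_iff.2 fun p => by
    ext i
    rw [coeff_mul_C, coeff_C_mul, Subring.mem_center_iff.1 ha]

/-- The polynomials with coefficients in `Λ`. -/
def polyParam (Λ : AddSubgroup F) : AddSubgroup F[X] where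
  carrier := {p | ∀ i, p.coeff i ∈ Λ}
  add_mem' hp hq i := by rw [coeff_add]; exact Λ.add_mem (hp i) (hq i)
  zero_mem' i := by rw [coeff_zero]; exact Λ.zero_mem
  neg_mem' hp i := by rw [coeff_neg]; exact Λ.neg_mem (hp i)

theorem C_mem_polyParam {Λ : AddSubgroup F} {a : F} (ha : a ∈ Λ) : C a ∈ polyParam Λ := fun i => by
  rw [coeff_C]; split_ifs
  · exact ha
  · exact Λ.zero_mem

/-- The involution fixes the indeterminate. For `conj_mem`, the cross terms of a sum `x + y` have
the form `c - lam * star c` with `c = star x * q * y`, so only monomials remain. There the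
coefficients are conjugated by a constant and shifted by an even degree. -/
theorem isFormParameter_poly {lam : F} {Λ : AddSubgroup F} (h : IsFormParameter lam Λ) :
    IsFormParameter (C lam) (polyParam Λ) where
  lam_central := C_mem_center h.lam_central
  lam_mul_star := by rw [star_C, ← C_mul, h.lam_mul_star, C_1]
  min_le p i := by
    rw [coeff_sub, coeff_C_mul, coeff_star]; exact h.min_le _
  le_max p hp := by
    ext i
    rw [coeff_neg, coeff_C_mul, coeff_star]; exact h.le_max _ (hp i)
  conj_mem p q hq := by
    have hq' : q = -(C lam * star q) := by
      ext i
      rw [coeff_neg, coeff_C_mul, coeff_star]; exact h.le_max _ (hq i)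
    have hlc : ∀ x : F[X], C lam * x = x * C lam := fun x =>
      (Subring.mem_center_iff.1 (C_mem_center h.lam_central) x).symm
    induction p using Polynomial.induction_on' with
    | add x y hx hy =>
      have e : star (x + y) * q * (x + y) = star x * q * x + star y * q * y +
          (star x * q * y - C lam * star (star x * q * y)) := by
        have e1 : C lam * star (star x * q * y) = -(star y * q * x) := by
          simp only [star_mul, star_star]
          rw [← mul_assoc, ← mul_assoc, hlc, mul_assoc (star y), ← neg_eq_iff_eq_neg, ← neg_mul,
            ← mul_neg, ← hq']
        rw [e1, star_add]
        noncomm_ring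
      rw [e]
      refine (polyParam Λ).add_mem ((polyParam Λ).add_mem hx hy) fun i => ?_
      rw [coeff_sub, coeff_C_mul, coeff_star]; exact h.min_le _
    | monomial k a =>
      have e : star (monomial k a) * q * monomial k a = C (star a) * q * C a * X ^ (2 * k) := by
        have hX : ∀ x : F[X], x * X ^ k = X ^ k * x := fun x => (X_pow_mul (n := k) (p := x)).symm
        rw [← C_mul_X_pow_eq_monomial, star_mul, star_pow, star_C, star_X, two_mul, pow_add,
          ← hX (C (star a)), mul_assoc (C (star a)), ← hX q]
        simp only [mul_assoc]
        rw [← mul_assoc (X ^ k) (C a), ← hX (C a)]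
        simp only [mul_assoc]
      rw [e]
      intro i
      rw [coeff_mul_X_pow']
      split_ifs
      · rw [coeff_mul_C, coeff_C_mul]; exact h.conj_mem _ _ (hq _)
      · exact Λ.zero_mem

theorem isFormParameter_pi {ι : Type*} {lam : F} {Λ : AddSubgroup F} (h : IsFormParameter lam Λ) :
    IsFormParameter (fun _ : ι => lam) (AddSubgroup.pi Set.univ fun _ : ι => Λ) where
  lam_central := Subring.mem_center_iff.2 fun g => funext fun i =>
    Subring.mem_center_iff.1 h.lam_central (g i)
  lam_mul_star := funext fun _ => h.lam_mul_star
  min_le a i _ := h.min_le (a i)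
  le_max _ ha := funext fun i => h.le_max _ (ha i trivial)
  conj_mem x _ ha i _ := h.conj_mem (x i) _ (ha i trivial)

end Poly

/-! ### Central localization of form rings. -/

section Localization

variable {R : Type*} [Ring R] (S : Submonoid (Subring.center R))

theorem locMap_apply (a : R) : locMap S a = LocalizedModule.mk a 1 := rfl

theorem locMap_eq_zero {a : R} (h : locMap S a = 0) : ∃ u ∈ S, (u : R) * a = 0 := by
  rw [locMap_apply, ← LocalizedModule.zero_mk 1, LocalizedModule.mk_eq] at h
  obtain ⟨u, hu⟩ := h
  rw [smul_zero, smul_zero, one_smul] at hu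
  exact ⟨u, u.2, hu⟩

theorem locMap_mul_mk (a : R) (s : S) :
    locMap S ((s : Subring.center R) : R) * LocalizedModule.mk a s = locMap S a := by
  rw [locMap_apply, locMap_apply, LocalizedModule.mk_mul_mk, one_mul]
  exact LocalizedModule.mk_eq.2 ⟨1, by simp [Submonoid.smul_def, Subring.smul_def]⟩

theorem isUnit_locMap (s : S) : IsUnit (locMap S ((s : Subring.center R) : R)) := by
  have h := locMap_mul_mk S 1 s
  rw [map_one] at h
  refine ⟨⟨_, LocalizedModule.mk 1 s, h, ?_⟩, rfl⟩
  rw [← h, locMap_apply, LocalizedModule.mk_mul_mk, LocalizedModule.mk_mul_mk, one_mul, mul_one,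
    one_mul, mul_one]

variable [StarRing R] [IsStarStable S]

theorem locMap_star (a : R) : locMap S (star a) = star (locMap S a) := by
  rw [locMap_apply, locMap_apply, star_mk]
  congr 1
  apply Subtype.ext; apply Subtype.ext; simp

/-- The lattice is the image of `(R, Λ)` itself, without denominators, so membership in a scaled
group can later be lifted to the unlocalized ring. -/
theorem formLattice_localization {lam : R} {Λ : AddSubgroup R} (h : IsFormParameter lam Λ)
    (hS : ∀ s ∈ S, s ∈ formScalars Λ) :
    FormLattice (locMap S lam) (locMap S).range (Λ.map (locMap S).toAddMonoidHom)
      (S.map ((locMap S).comp (Subring.center R).subtype)) where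
  lam_central x := by
    induction x using LocalizedModule.induction_on with
    | h a s =>
      rw [locMap_apply, LocalizedModule.mk_mul_mk, LocalizedModule.mk_mul_mk, one_mul, mul_one,
        Subring.mem_center_iff.1 h.lam_central]
  lam_mul_star := by rw [← locMap_star, ← map_mul, h.lam_mul_star, map_one]
  lam_mem := ⟨lam, rfl⟩
  star_mem := by
    rintro _ ⟨b, rfl⟩
    exact ⟨star b, locMap_star S b⟩
  le := by
    rintro _ ⟨a, _, rfl⟩
    exact ⟨a, rfl⟩
  min_le := by
    rintro _ ⟨b, rfl⟩
    exact ⟨_, h.min_le b, by simp [locMap_star]⟩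
  le_max := by
    rintro _ ⟨a, ha, rfl⟩
    have := congrArg (locMap S) (h.le_max a ha)
    simpa [locMap_star] using this
  conj_mem := by
    rintro _ ⟨b, rfl⟩ _ ⟨a, ha, rfl⟩
    exact ⟨_, h.conj_mem b a ha, by simp [locMap_star]⟩
  central := by
    rintro _ ⟨t, ht, rfl⟩ x
    induction x using LocalizedModule.induction_on with
    | h a s =>
      rw [RingHom.comp_apply, locMap_apply, LocalizedModule.mk_mul_mk, LocalizedModule.mk_mul_mk,
        one_mul, mul_one]
      congr 1
      exact center_comm t a
  star_eq := by
    rintro _ ⟨t, ht, rfl⟩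
    have := congrArg (locMap S) (hS t ht).1
    rw [locMap_star] at this
    exact this
  mem := by
    rintro _ ⟨t, _, rfl⟩
    exact ⟨t, rfl⟩
  mul_mem := by
    rintro _ ⟨t, ht, rfl⟩ _ ⟨a, ha, rfl⟩
    exact ⟨_, (hS t ht).2 a ha, by simp⟩

end Localization

/-! ### Extension of homomorphisms to the localization. -/

section Lift

variable {R : Type*} [Ring R] (S : Submonoid (Subring.center R)) {C : Type*} [Ring C]

/-- The extension to `S⁻¹R` of a ring homomorphism that inverts `S`. -/
noncomputable def locLift (f : R →+* C) (hf : ∀ s : S, IsUnit (f ((s : Subring.center R) : R))) :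
    LocalizedModule S R →+* C := by
  have hcomm : ∀ (s : S) (a : R), f ((s : Subring.center R) : R) * f a =
      f a * f ((s : Subring.center R) : R) := fun s a => by
    rw [← map_mul, center_comm, map_mul]
  let g : LocalizedModule S R → C := fun x => LocalizedModule.liftOn x
    (fun p => ((hf p.2).unit⁻¹ : Cˣ) * f p.1) (by
      rintro ⟨a, s⟩ ⟨b, t⟩ ⟨u, hu⟩
      have hu' := congrArg f hu
      simp only [Submonoid.smul_def, Subring.smul_def, smul_eq_mul, map_mul] at hu'
      have hst := (hf u).mul_left_cancel hu'
      rw [Units.inv_mul_eq_iff_eq_mul, IsUnit.unit_spec]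
      refine (hf t).mul_left_cancel ?_
      rw [hst, ← mul_assoc (f _) (f _), hcomm t, mul_assoc, ← mul_assoc (f _) (Units.val _),
        IsUnit.mul_val_inv, one_mul])
  have hg : ∀ a (s : S), f ((s : Subring.center R) : R) * g (LocalizedModule.mk a s) = f a := by
    intro a s
    change f _ * LocalizedModule.liftOn _ _ _ = _
    rw [LocalizedModule.liftOn_mk, ← mul_assoc, IsUnit.mul_val_inv, one_mul]
  have huniq : ∀ a (s : S) x, f ((s : Subring.center R) : R) * x = f a →
      x = g (LocalizedModule.mk a s) := fun a s x hx => (hf s).mul_left_cancel (hx.trans (hg a s).symm)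
  have hgc : ∀ (t : S) a (s : S), f ((t : Subring.center R) : R) * g (LocalizedModule.mk a s) =
      g (LocalizedModule.mk a s) * f ((t : Subring.center R) : R) := by
    intro t a s
    refine (hf s).mul_left_cancel ?_
    rw [← mul_assoc, ← mul_assoc, hg, hcomm, mul_assoc, hg, hcomm]
  have hone : g 1 = 1 := by
    rw [← map_one (locMap S), locMap_apply]
    exact (huniq _ _ _ (by simp)).symm
  have hzero : g 0 = 0 := by
    rw [← LocalizedModule.zero_mk 1]
    exact (huniq _ _ _ (by simp)).symm
  have hmul : ∀ x y, g (x * y) = g x * g y := by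
    intro x y
    induction x using LocalizedModule.induction_on with
    | h a s =>
      induction y using LocalizedModule.induction_on with
      | h b t =>
        rw [LocalizedModule.mk_mul_mk]
        refine (huniq _ _ _ ?_).symm
        rw [Submonoid.coe_mul, Subring.coe_mul, map_mul, mul_assoc, ← mul_assoc (f _) (g _) (g _),
          hgc, mul_assoc (g _), hg, ← mul_assoc, hg, map_mul]
  have hadd : ∀ x y, g (x + y) = g x + g y := by
    intro x y
    induction x using LocalizedModule.induction_on with
    | h a s =>
      induction y using LocalizedModule.induction_on with
      | h b t =>
        rw [LocalizedModule.mk_add_mk]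
        refine (huniq _ _ _ ?_).symm
        simp only [Submonoid.smul_def, Subring.smul_def, smul_eq_mul, map_mul, map_add,
          Submonoid.coe_mul, Subring.coe_mul, mul_add, mul_assoc, hg]
        rw [← mul_assoc (f _) (f _) (g _), hcomm s, mul_assoc, hg]
  exact { toFun := g, map_one' := hone, map_mul' := hmul, map_zero' := hzero, map_add' := hadd }

theorem mul_locLift_mk (f : R →+* C) (hf : ∀ s : S, IsUnit (f ((s : Subring.center R) : R)))
    (a : R) (s : S) :
    f ((s : Subring.center R) : R) * locLift S f hf (LocalizedModule.mk a s) = f a := by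
  have h : locLift S f hf (LocalizedModule.mk a s) = ((hf s).unit⁻¹ : Cˣ) * f a := rfl
  rw [h, ← mul_assoc, IsUnit.mul_val_inv, one_mul]

theorem eq_locLift_mk (f : R →+* C) (hf : ∀ s : S, IsUnit (f ((s : Subring.center R) : R)))
    (a : R) (s : S) {x : C} (hx : f ((s : Subring.center R) : R) * x = f a) :
    locLift S f hf (LocalizedModule.mk a s) = x :=
  (hf s).mul_left_cancel ((mul_locLift_mk S f hf a s).trans hx.symm)

theorem locLift_locMap (f : R →+* C) (hf : ∀ s : S, IsUnit (f ((s : Subring.center R) : R)))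
    (a : R) : locLift S f hf (locMap S a) = f a :=
  eq_locLift_mk S f hf a 1 (by simp)

variable [StarRing R] [IsStarStable S] [StarRing C]

theorem locLift_star (f : R →+* C) (hf : ∀ s : S, IsUnit (f ((s : Subring.center R) : R)))
    (hs : ∀ a, f (star a) = star (f a)) (x : LocalizedModule S R) :
    locLift S f hf (star x) = star (locLift S f hf x) := by
  induction x using LocalizedModule.induction_on with
  | h a s =>
    rw [star_mk]
    refine eq_locLift_mk S f hf _ _ ?_
    rw [coe_setStar, hs, hs, ← star_mul]
    congr 1
    have h1 : f ((s : Subring.center R) : R) * (locLift S f hf (LocalizedModule.mk a s : LocalizedModule S R) *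
        f ((s : Subring.center R) : R)) = f ((s : Subring.center R) : R) * f a := by
      rw [← mul_assoc, mul_locLift_mk, ← map_mul, ← map_mul, center_comm]
    exact (hf s).mul_left_cancel h1

end Lift

/-! ### Integrality of `C(R_0)` over the degree-zero scalars. -/

section Integrality

variable {R : Type*} [Ring R] [StarRing R] (𝒜 : ℕ → AddSubgroup R) [GradedRing 𝒜]

/-- For homogeneous `a` of degree `i`, compare the components of degree `i` in `a * z = z * a`. -/
theorem proj_zero_mem_center {z : R} (hz : z ∈ Subring.center R) :
    GradedRing.projZeroRingHom 𝒜 z ∈ Subring.center R := by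
  refine Subring.mem_center_iff.2 fun r => ?_
  refine graded_induction 𝒜 (P := fun r => r * GradedRing.projZeroRingHom 𝒜 z =
    GradedRing.projZeroRingHom 𝒜 z * r) (by simp)
    (fun a b ha hb => by rw [add_mul, mul_add, ha, hb]) (fun i a ha => ?_) r
  have h1 := DirectSum.coe_decompose_mul_add_of_left_mem 𝒜 (j := 0) (b := z) ha
  have h2 := DirectSum.coe_decompose_mul_add_of_right_mem 𝒜 (i := 0) (a := z) ha
  rw [add_zero] at h1
  rw [zero_add] at h2
  rw [GradedRing.projZeroRingHom_apply, ← h1, ← h2, Subring.mem_center_iff.1 hz]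

/-- The central elements of degree zero. -/
def centerZero : Subring (Subring.center R) where
  carrier := {z | (z : R) ∈ 𝒜 0}
  mul_mem' ha hb := SetLike.mul_mem_graded (A := 𝒜) ha hb
  one_mem' := SetLike.one_mem_graded 𝒜
  add_mem' ha hb := (𝒜 0).add_mem ha hb
  zero_mem' := (𝒜 0).zero_mem
  neg_mem' ha := (𝒜 0).neg_mem ha

/-- The elements of degree zero in `formScalars Λ`. -/
def gradedScalars (Λ : AddSubgroup R) : Subring (formScalars Λ) :=
  (centerZero 𝒜).comap (formScalars Λ).subtype

/-- The inclusion of the central elements of degree zero into the center of `R_0`. -/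
def centerZeroToCenter : centerZero 𝒜 →+* Subring.center (𝒜 0) where
  toFun z := ⟨⟨z.1.1, z.2⟩, Subring.mem_center_iff.2 fun g =>
    Subtype.ext (Subring.mem_center_iff.1 z.1.2 g)⟩
  map_one' := rfl
  map_mul' _ _ := rfl
  map_zero' := rfl
  map_add' _ _ := rfl

/-- The inclusion of `gradedScalars 𝒜 Λ` into the central elements of degree zero. -/
def gradedScalarsToCenterZero (Λ : AddSubgroup R) : gradedScalars 𝒜 Λ →+* centerZero 𝒜 where
  toFun k := ⟨k.1.1, k.2⟩
  map_one' := rfl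
  map_mul' _ _ := rfl
  map_zero' := rfl
  map_add' _ _ := rfl

open Polynomial

/-- Finiteness of `R` over `C(R)` gives a monic equation over `C(R)`. Projecting it to degree zero,
a ring homomorphism fixing `R_0`, puts its coefficients in the central elements of degree zero. -/
theorem centerZeroToCenter_isIntegral [Module.Finite (Subring.center R) R] :
    (centerZeroToCenter 𝒜).IsIntegral := by
  intro x
  obtain ⟨p, hp, hpx⟩ := IsIntegral.of_finite (Subring.center R) ((x : 𝒜 0) : R)
  let P₀ := GradedRing.projZeroRingHom 𝒜
  let π : Subring.center R →+* centerZero 𝒜 :=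
    { toFun := fun z => ⟨⟨P₀ z, proj_zero_mem_center 𝒜 z.2⟩, by
        change P₀ (z : R) ∈ 𝒜 0
        rw [GradedRing.projZeroRingHom_apply]
        exact SetLike.coe_mem _⟩
      map_one' := Subtype.ext (Subtype.ext (map_one P₀))
      map_mul' := fun a b => Subtype.ext (Subtype.ext (map_mul P₀ (a : R) b))
      map_zero' := Subtype.ext (Subtype.ext (map_zero P₀))
      map_add' := fun a b => Subtype.ext (Subtype.ext (map_add P₀ (a : R) b)) }
  let incl : Subring.center (𝒜 0) →+* R :=
    { toFun := fun c => ((c : 𝒜 0) : R)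
      map_one' := rfl
      map_mul' := fun _ _ => rfl
      map_zero' := rfl
      map_add' := fun _ _ => rfl }
  have hincl : Function.Injective incl := fun a b h => Subtype.ext (Subtype.ext h)
  refine ⟨p.map π, hp.map π, hincl ?_⟩
  have h1 := congrArg P₀ hpx
  rw [hom_eval₂, map_zero] at h1
  have hx : P₀ ((x : 𝒜 0) : R) = ((x : 𝒜 0) : R) := by
    simp only [P₀, GradedRing.projZeroRingHom_apply]
    exact DirectSum.decompose_of_mem_same 𝒜 (SetLike.coe_mem _)
  rw [hx] at h1
  rw [hom_eval₂, map_zero, eval₂_map]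
  exact h1

variable {𝒜} {lam : R} {Λ : AddSubgroup R}

/-- For central `z`, multiplication by the norm is `a ↦ star z * a * z`, under which `Λ` is closed.
-/
theorem norm_mem_formScalars (hΛ : IsFormParameter lam Λ) (z : Subring.center R) :
    z * centerStar z ∈ formScalars Λ := by
  refine ⟨by simp, fun a ha => ?_⟩
  have := hΛ.conj_mem (z : R) a ha
  rw [← center_comm] at this
  rwa [Subring.coe_mul, mul_assoc, coe_centerStar]

/-- A central `z` is a root of `X ^ 2 - (z + star z) X + z * star z`, whose coefficients are scalars
of the required kind. -/
theorem gradedScalarsToCenterZero_isIntegral (hΛ : IsFormParameter lam Λ)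
    (hgr : IsGradedForm 𝒜 lam Λ) : (gradedScalarsToCenterZero 𝒜 Λ).IsIntegral := by
  intro z
  have hst : (centerStar z.1 : R) ∈ 𝒜 0 := hgr.star_mem 0 _ z.2
  let z' : centerZero 𝒜 := ⟨centerStar z.1, hst⟩
  have hN : ∀ y : centerZero 𝒜, ∃ k : gradedScalars 𝒜 Λ,
      (gradedScalarsToCenterZero 𝒜 Λ k).1 = y.1 * centerStar y.1 := fun y =>
    ⟨⟨⟨_, norm_mem_formScalars hΛ y.1⟩, SetLike.mul_mem_graded (A := 𝒜) y.2
      (hgr.star_mem 0 _ y.2)⟩, rfl⟩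
  obtain ⟨d, hd⟩ := hN z
  obtain ⟨e, he⟩ := hN (1 + z)
  have hd' : gradedScalarsToCenterZero 𝒜 Λ d = z * z' := Subtype.ext hd
  have he' : gradedScalarsToCenterZero 𝒜 Λ e = (1 + z) * (1 + z') := by
    refine Subtype.ext (he.trans ?_)
    congr 1
    exact Subtype.ext (by simp [z'])
  -- The trace multiplies `Λ` into itself because it is a combination of norms: `N(1 + z) - 1 -
  -- N(z)`.
  obtain ⟨c, hc⟩ : ∃ c, gradedScalarsToCenterZero 𝒜 Λ c = -(z + z') :=
    ⟨-(e - 1 - d), by rw [map_neg, map_sub, map_sub, map_one, hd', he']; ring⟩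
  refine ⟨X ^ 2 + (C c * X + C d), ?_, ?_⟩
  · refine monic_X_pow_add ?_
    refine lt_of_le_of_lt (degree_linear_le) ?_
    norm_num
  · simp only [eval₂_add, eval₂_mul, eval₂_pow, eval₂_X, eval₂_C, hd', hc]
    ring

theorem exists_maximal_over [Module.Finite (Subring.center R) R] (hΛ : IsFormParameter lam Λ)
    (hgr : IsGradedForm 𝒜 lam Λ) (P : Ideal (gradedScalars 𝒜 Λ)) [P.IsMaximal] :
    ∃ m : MaximalSpectrum (Subring.center (𝒜 0)), ∀ k ∈ P,
      centerZeroToCenter 𝒜 (gradedScalarsToCenterZero 𝒜 Λ k) ∈ m.asIdeal := by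
  let ι := (centerZeroToCenter 𝒜).comp (gradedScalarsToCenterZero 𝒜 Λ)
  have hint : ι.IsIntegral := RingHom.IsIntegral.trans _ _
    (gradedScalarsToCenterZero_isIntegral hΛ hgr) (centerZeroToCenter_isIntegral 𝒜)
  let _ : Algebra (gradedScalars 𝒜 Λ) (Subring.center (𝒜 0)) := ι.toAlgebra
  have : Algebra.IsIntegral (gradedScalars 𝒜 Λ) (Subring.center (𝒜 0)) := ⟨hint⟩
  have hinj : Function.Injective ι := fun a b h => by
    have h' := congrArg (fun c : Subring.center (𝒜 0) => ((c : 𝒜 0) : R)) h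
    exact Subtype.ext (Subtype.ext (Subtype.ext h'))
  obtain ⟨Q, hQ, hQP⟩ := Ideal.exists_ideal_over_maximal_of_isIntegral
    (S := Subring.center (𝒜 0)) P fun x hx => by
      have h0 : x = 0 := hinj (Eq.trans hx (map_zero ι).symm)
      rw [h0]; exact P.zero_mem
  exact ⟨⟨Q, hQ⟩, fun k hk => by rw [← hQP] at hk; exact hk⟩

end Integrality

theorem mul_sub_eq_zero_symm {A : Type*} [Ring A] {c x y : A} (h : c * (x - y) = 0) :
    c * (y - x) = 0 := by
  rw [← neg_sub, mul_neg, h, neg_zero]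

/-! ### The universal family of dilations. -/

section Family

variable {R : Type*} [Ring R] [StarRing R] (Λ : AddSubgroup R)

/-- Polynomials over the ring of functions from `formScalars Λ` to `R`. -/
abbrev FamilyRing : Type _ := Polynomial (formScalars Λ → R)

/-- The form parameter of `FamilyRing Λ` induced by `Λ`. -/
def familyParam : AddSubgroup (FamilyRing Λ) :=
  polyParam (AddSubgroup.pi Set.univ fun _ : formScalars Λ => Λ)

/-- The constants of `FamilyRing Λ`. -/
noncomputable def familyConst : R →+* FamilyRing Λ :=
  Polynomial.C.comp (Pi.constRingHom (formScalars Λ) R)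

theorem familyConst_star (a : R) : familyConst Λ (star a) = star (familyConst Λ a) :=
  (star_C (F := formScalars Λ → R) _).symm

theorem familyConst_mem_param {a : R} (ha : a ∈ Λ) : familyConst Λ a ∈ familyParam Λ :=
  C_mem_polyParam fun _ _ => ha

theorem isFormParameter_family {lam : R} (h : IsFormParameter lam Λ) :
    IsFormParameter (familyConst Λ lam) (familyParam Λ) :=
  isFormParameter_poly (isFormParameter_pi h)

/-- A function from `formScalars Λ` to itself as a scalar of `FamilyRing Λ`. -/
noncomputable def familyScalar (g : formScalars Λ → formScalars Λ) :
    formScalars (familyParam Λ) where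
  val := ⟨Polynomial.C fun b => ((g b).1 : R), C_mem_center <| Subring.mem_center_iff.2 fun x =>
    funext fun b => Subring.mem_center_iff.1 (g b).1.2 (x b)⟩
  property := by
    refine ⟨?_, fun p hp i => ?_⟩
    · change star (Polynomial.C _) = _
      rw [star_C]
      congr 1
      exact funext fun b => (g b).2.1
    · change (Polynomial.C _ * p).coeff i ∈ _
      rw [Polynomial.coeff_C_mul]
      exact fun b _ => (g b).2.2 _ (hp i b trivial)

/-- The indeterminate as a scalar of `FamilyRing Λ`. -/
noncomputable def familyX : formScalars (familyParam Λ) where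
  val := ⟨Polynomial.X, X_mem_center⟩
  property := by
    refine ⟨star_X, fun p hp i => ?_⟩
    change (Polynomial.X * p).coeff i ∈ _
    cases i with
    | zero => rw [Polynomial.coeff_X_mul_zero]; exact AddSubgroup.zero_mem _
    | succ i => rw [Polynomial.coeff_X_mul]; exact hp i

/-- The constant scalars of `FamilyRing Λ`. -/
noncomputable def familyConstScalar : formScalars Λ →+* formScalars (familyParam Λ) where
  toFun w := familyScalar Λ fun _ => w
  map_one' := Subtype.ext (Subtype.ext (map_one (familyConst Λ)))
  map_mul' v w := Subtype.ext (Subtype.ext (map_mul (familyConst Λ) (v.1 : R) w.1))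
  map_zero' := Subtype.ext (Subtype.ext (map_zero (familyConst Λ)))
  map_add' v w := Subtype.ext (Subtype.ext (map_add (familyConst Λ) (v.1 : R) w.1))

variable {Λ} in
/-- Evaluation at the argument `b` and at the value `z` of the indeterminate. -/
noncomputable def familyEval (b z : formScalars Λ) : FamilyRing Λ →+* R :=
  Polynomial.eval₂RingHom' (Pi.evalRingHom (fun _ => R) b) (z.1 : R)
    fun a => (center_comm z.1 (a b)).symm

variable {Λ}

theorem familyEval_C (b z : formScalars Λ) (f : formScalars Λ → R) :
    familyEval b z (Polynomial.C f) = f b :=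
  Polynomial.eval₂_C _ _

theorem familyEval_X (b z : formScalars Λ) : familyEval b z Polynomial.X = (z.1 : R) :=
  Polynomial.eval₂_X _ _

theorem familyEval_const (b z : formScalars Λ) (a : R) : familyEval b z (familyConst Λ a) = a :=
  familyEval_C b z _

theorem familyEval_eq_sum (b z : formScalars Λ) (p : FamilyRing Λ) :
    familyEval b z p = ∑ i ∈ Finset.range (p.natDegree + 1), p.coeff i b * (z.1 : R) ^ i :=
  Polynomial.eval₂_eq_sum_range _ _

theorem familyEval_star (b z : formScalars Λ) (p : FamilyRing Λ) :
    familyEval b z (star p) = star (familyEval b z p) := by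
  induction p using Polynomial.induction_on' with
  | add p q hp hq => rw [star_add, map_add, hp, hq, map_add, star_add]
  | monomial k f =>
    have hz : star (z.1 : R) = z.1 := z.2.1
    rw [← Polynomial.C_mul_X_pow_eq_monomial, star_mul, star_pow, star_X, star_C, map_mul, map_mul,
      map_pow, familyEval_X, familyEval_C, familyEval_C, star_mul, star_pow, hz]
    rfl

theorem familyEval_mem_param (b z : formScalars Λ) {p : FamilyRing Λ} (hp : p ∈ familyParam Λ) :
    familyEval b z p ∈ Λ := by
  rw [familyEval_eq_sum]
  refine Λ.sum_mem fun i _ => ?_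
  have := (z ^ i).2.2 _ (hp i b trivial)
  rw [center_comm] at this
  exact this

/-- Every coefficient is killed by `u`, and every positive power of `u * z` contains a factor `u`.
Only the constant term remains. -/
theorem familyEval_of_torsion (b z u : formScalars Λ) {p : FamilyRing Λ}
    (hp : familyConst Λ (u.1 : R) * p = 0) :
    familyEval b (u * z) p = familyEval b 0 p := by
  have hc : ∀ i, (u.1 : R) * p.coeff i b = 0 := fun i => by
    have := congrArg (fun q : FamilyRing Λ => q.coeff i b) hp
    simpa [familyConst] using this
  rw [familyEval_eq_sum, familyEval_eq_sum]
  refine Finset.sum_congr rfl fun i _ => ?_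
  cases i with
  | zero => simp
  | succ i =>
    have h1 : ((u * z).1 : R) ^ (i + 1) = (u.1 : R) * ((z.1 : R) * ((u * z).1 : R) ^ i) := by
      rw [pow_succ', ← mul_assoc]; rfl
    rw [h1, ← mul_assoc, ← center_comm u.1, hc]
    simp

variable (Λ) in
/-- The projection of `FamilyRing Λ` to the polynomials of degree zero. -/
noncomputable def familyRetract : FamilyRing Λ →+* FamilyRing Λ :=
  Polynomial.C.comp Polynomial.constantCoeff

theorem familyRetract_C (f : formScalars Λ → R) :
    familyRetract Λ (Polynomial.C f) = Polynomial.C f := by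
  simp [familyRetract]

theorem familyRetract_X : familyRetract Λ Polynomial.X = 0 := by
  simp [familyRetract]

theorem familyEval_retract (b z : formScalars Λ) (p : FamilyRing Λ) :
    familyEval b z (familyRetract Λ p) = familyEval b 0 p := by
  have h : (familyEval b z).comp (familyRetract Λ) = familyEval b 0 := by
    refine Polynomial.ringHom_ext (fun f => ?_) ?_
    · rw [RingHom.comp_apply, familyRetract_C, familyEval_C, familyEval_C]
    · rw [RingHom.comp_apply, familyRetract_X, familyEval_X, map_zero]; simp
  exact congrArg (fun f => f p) h

section Hom

variable (𝒜 : ℕ → AddSubgroup R) [GradedRing 𝒜]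

variable (Λ) in
/-- The homomorphism to `FamilyRing Λ` that multiplies `R_i` by the `i`-th power of `b + w X`, where
`b` denotes the identity function of `formScalars Λ`. -/
noncomputable def familyHom (w : formScalars Λ) : R →+* FamilyRing Λ :=
  gscale 𝒜 (familyConst Λ) (familyScalar Λ id + familyConstScalar Λ w * familyX Λ).1

/-- The homomorphism `R → R` that multiplies `R_i` by `k ^ i`. -/
noncomputable def dilate (k : formScalars Λ) : R →+* R := gscale 𝒜 (RingHom.id R) k.1

/-- All dilations by `b + w * z` are thus specializations of one homomorphism, which makes the later
choice of `w` uniform in `b`. -/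
theorem familyEval_comp_familyHom (b z w : formScalars Λ) :
    (familyEval b z).comp (familyHom Λ 𝒜 w) = dilate 𝒜 (b + w * z) := by
  ext a
  have h : (familyEval b z).comp (familyConst Λ) = RingHom.id R :=
    RingHom.ext fun a => familyEval_const b z a
  rw [RingHom.comp_apply, familyHom, map_gscale 𝒜 (familyEval b z) _ _ (b + w * z).1, h]
  · rfl
  · change familyEval b z (Polynomial.C _ + familyConst Λ (w.1 : R) * Polynomial.X) = _
    rw [map_add, map_mul, familyEval_C, familyEval_const, familyEval_X]
    rfl

theorem familyRetract_comp_familyHom (w : formScalars Λ) :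
    (familyRetract Λ).comp (familyHom Λ 𝒜 w) = familyHom Λ 𝒜 0 := by
  ext1 a
  have h : (familyRetract Λ).comp (familyConst Λ) = familyConst Λ :=
    RingHom.ext fun a => familyRetract_C _
  rw [RingHom.comp_apply, familyHom, map_gscale 𝒜 (familyRetract Λ) _ _
    (familyScalar Λ id + familyConstScalar Λ 0 * familyX Λ).1, h]
  · rfl
  · rw [map_zero, zero_mul, add_zero]
    change familyRetract Λ (Polynomial.C _ + familyConst Λ (w.1 : R) * Polynomial.X) = _
    rw [map_add, map_mul, familyRetract_C, familyRetract_X, mul_zero, add_zero]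
    rfl

theorem familyHom_of_mem_zero (w : formScalars Λ) {a : R} (ha : a ∈ 𝒜 0) :
    familyHom Λ 𝒜 w a = familyConst Λ a := by
  rw [familyHom, gscale_of_mem 𝒜 _ _ ha, pow_zero, mul_one]

variable {lam : R}

theorem familyHom_star (hgr : IsGradedForm 𝒜 lam Λ) (w : formScalars Λ) (a : R) :
    familyHom Λ 𝒜 w (star a) = star (familyHom Λ 𝒜 w a) :=
  gscale_star 𝒜 hgr _ (familyConst_star Λ) _
    (familyScalar Λ id + familyConstScalar Λ w * familyX Λ).2.1 a

theorem familyHom_mem_param (hgr : IsGradedForm 𝒜 lam Λ) (w : formScalars Λ) {a : R}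
    (ha : a ∈ Λ) : familyHom Λ 𝒜 w a ∈ familyParam Λ :=
  gscale_mem_param 𝒜 hgr _ (fun _ h => familyConst_mem_param Λ h) _ ha

theorem familyConstScalar_dvd (w : formScalars Λ) :
    familyConstScalar Λ w ∣ (familyScalar Λ id + familyConstScalar Λ w * familyX Λ) -
      (familyScalar Λ id + familyConstScalar Λ 0 * familyX Λ) :=
  ⟨familyX Λ, by rw [map_zero, zero_mul, add_zero, add_sub_cancel_left]⟩

theorem exists_familyHom_sub (w : formScalars Λ) (a : R) :
    ∃ b, familyHom Λ 𝒜 w a - familyHom Λ 𝒜 0 a = familyConst Λ (w.1 : R) * b :=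
  exists_gscale_sub_gscale 𝒜 (familyConst Λ) _ _ _ (familyConstScalar_dvd w) a

theorem exists_familyHom_sub_param (hgr : IsGradedForm 𝒜 lam Λ) (w : formScalars Λ) {a : R}
    (ha : a ∈ Λ) : ∃ b ∈ familyParam Λ,
      familyHom Λ 𝒜 w a - familyHom Λ 𝒜 0 a = familyConst Λ (w.1 : R) * b :=
  exists_gscale_sub_gscale_param 𝒜 hgr (familyConst Λ) (fun _ h => familyConst_mem_param Λ h) _ _ _
    (familyConstScalar_dvd w) ha

end Hom

/-! ### Removing torsion by substitution. -/

section Descent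

variable (𝒜 : ℕ → AddSubgroup R) [GradedRing 𝒜] {lam : R} {n : ℕ}

/-- If the image of `α` in the family ring agrees, up to `u`-torsion, with an elementary matrix, then
the dilations of `α` are locally constant modulo the elementary group. -/
theorem dilate_mul_inv_mem_of_torsion
    (α : (Matrix (Fin n ⊕ Fin n) (Fin n ⊕ Fin n) R)ˣ) (t u : formScalars Λ)
    {η : (Matrix (Fin n ⊕ Fin n) (Fin n ⊕ Fin n) (FamilyRing Λ))ˣ}
    (hη : η ∈ elemGroup n (familyConst Λ lam) Set.univ (familyParam Λ : Set (FamilyRing Λ)))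
    (hu : ∀ i j, familyConst Λ (u.1 : R) *
      ((glMap n (familyHom Λ 𝒜 t) α * (glMap n (familyHom Λ 𝒜 0) α)⁻¹).val i j - η.val i j) = 0)
    (b v : formScalars Λ) :
    glMap n (dilate 𝒜 (b + t * (u * v))) α * (glMap n (dilate 𝒜 b) α)⁻¹ ∈ EQ n lam Λ := by
  set θ := glMap n (familyHom Λ 𝒜 t) α * (glMap n (familyHom Λ 𝒜 0) α)⁻¹ with hθ
  have hEQ : ∀ z, glMap n (familyEval b z) η ∈ EQ n lam Λ := fun z => by
    rw [EQ_eq_elemGroup]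
    exact elemGroup_le_comap (familyEval b z) (familyEval_star b z) (familyEval_const b z lam)
      (fun _ _ => Set.mem_univ _) (fun a ha => familyEval_mem_param b z ha) hη
  have hθ1 : glMap n (familyEval b (u * v)) θ =
      glMap n (dilate 𝒜 (b + t * (u * v))) α * (glMap n (dilate 𝒜 b) α)⁻¹ := by
    rw [hθ, map_mul, map_inv, glMap_comp, glMap_comp, familyEval_comp_familyHom,
      familyEval_comp_familyHom, zero_mul, add_zero]
  have hθe : glMap n (familyRetract Λ) θ = 1 := by
    rw [hθ, map_mul, map_inv, glMap_comp, glMap_comp, familyRetract_comp_familyHom,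
      familyRetract_comp_familyHom, mul_inv_cancel]
  have hcomp : ∀ z, (familyEval b z).comp (familyRetract Λ) = familyEval b 0 := fun z =>
    RingHom.ext fun p => familyEval_retract b z p
  have hθ0 : glMap n (familyEval b 0) θ = 1 := by
    rw [← hcomp 0, ← glMap_comp, hθe, map_one]
  set U : Subring.center (FamilyRing Λ) := (familyConstScalar Λ u).1 with hU
  have hu1 : U • (θ.val - η.val) = 0 := by
    ext1 i j
    exact hu i j
  have hu2 : U • ((glMap n (familyRetract Λ) η).val - 1) = 0 := by
    rw [← Units.val_one, ← hθe]
    ext1 i j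
    have h1 := congrArg (familyRetract Λ) (hu i j)
    rw [map_mul, map_zero, map_sub] at h1
    have h2 : familyRetract Λ (familyConst Λ (u.1 : R)) = familyConst Λ (u.1 : R) :=
      familyRetract_C _
    rw [h2] at h1
    exact mul_sub_eq_zero_symm h1
  -- Write `η(0)` for the constant part of `η`. As `θ` retracts to `1`, `η(0) - 1` is also
  -- `u`-torsion, so correcting `θ` by `η(0)` keeps the difference from `η` a torsion matrix and
  -- makes its value at `X = 0` vanish.
  have hM : U • (θ.val * (glMap n (familyRetract Λ) η).val - η.val) = 0 := by
    have e : θ.val * (glMap n (familyRetract Λ) η).val - η.val =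
        θ.val * ((glMap n (familyRetract Λ) η).val - 1) + (θ.val - η.val) := by
      rw [mul_sub, mul_one]; abel
    rw [e, smul_add, ← Matrix.mul_smul, hu2, hu1, mul_zero, add_zero]
  -- The torsion matrix takes the same value at `u * v` as at `0`, namely zero. Hence the value of
  -- `θ` at `u * v` is the quotient of the values of `η` at `u * v` and at `0`, both elementary.
  have key : glMap n (familyEval b (u * v)) θ * glMap n (familyEval b 0) η =
      glMap n (familyEval b (u * v)) η := by
    have h1 : (θ.val * (glMap n (familyRetract Λ) η).val - η.val).map (familyEval b (u * v)) =
        (θ.val * (glMap n (familyRetract Λ) η).val - η.val).map (familyEval b 0) := by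
      ext1 i j
      exact familyEval_of_torsion b v u (congrFun (congrFun hM i) j)
    have h2 : ∀ z, (θ.val * (glMap n (familyRetract Λ) η).val - η.val).map (familyEval b z) =
        (glMap n (familyEval b z) θ * glMap n (familyEval b 0) η).val -
          (glMap n (familyEval b z) η).val := fun z => by
      rw [Matrix.map_sub _ (map_sub _), Matrix.map_mul, ← hcomp z, ← glMap_comp]
      rfl
    rw [h2, h2, hθ0, one_mul, sub_self, sub_eq_zero] at h1
    exact Units.ext h1
  rw [← hθ1, ← mul_inv_eq_iff_eq_mul.2 key.symm]
  exact Subgroup.mul_mem _ (hEQ _) (Subgroup.inv_mem _ (hEQ _))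

end Descent

end Family

/-! ### Dilations of a locally elementary matrix. -/

section Local

variable {R : Type*} [Ring R] [StarRing R]

theorem centerStar_mul (z w : Subring.center R) :
    centerStar (z * w) = centerStar z * centerStar w := by
  apply Subtype.ext
  simp only [coe_centerStar, Subring.coe_mul, star_mul]
  exact (center_comm (centerStar z) (star (w : R))).symm

/-- The norms `z * star z` of the elements of `S`. -/
def normSubmonoid (S : Submonoid (Subring.center R)) (Λ : AddSubgroup R) :
    Submonoid (formScalars Λ) where
  carrier := {w | ∃ z ∈ S, w.1 = z * centerStar z}
  one_mem' := ⟨1, S.one_mem, Subtype.ext (by simp)⟩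
  mul_mem' := by
    rintro v w ⟨y, hy, hvy⟩ ⟨z, hz, hwz⟩
    refine ⟨y * z, S.mul_mem hy hz, ?_⟩
    rw [Subring.coe_mul, hvy, hwz, centerStar_mul]
    ring

/-- The image of a multiplicative set of scalars in the center of the family ring. -/
noncomputable def familySubmonoid {Λ : AddSubgroup R} (T : Submonoid (formScalars Λ)) :
    Submonoid (Subring.center (FamilyRing Λ)) :=
  T.map ((formScalars (familyParam Λ)).subtype.comp (familyConstScalar Λ))

theorem familySubmonoid_le {Λ : AddSubgroup R} (T : Submonoid (formScalars Λ)) :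
    ∀ s ∈ familySubmonoid T, s ∈ formScalars (familyParam Λ) := by
  rintro _ ⟨t, _, rfl⟩
  exact (familyConstScalar Λ t).2

instance {Λ : AddSubgroup R} (T : Submonoid (formScalars Λ)) :
    IsStarStable (familySubmonoid T) where
  star_mem z hz := by
    have : centerStar z = z := Subtype.ext (familySubmonoid_le T z hz).1
    rwa [this]

/-- The filter of sets that contain all multiples of some element of `T`. -/
def multiplesFilter {K : Type*} [CommRing K] (T : Submonoid K) : Filter K where
  sets := {s | ∃ t ∈ T, ∀ w, t ∣ w → w ∈ s}
  univ_sets := ⟨1, T.one_mem, fun _ _ => Set.mem_univ _⟩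
  sets_of_superset := by
    rintro s s' ⟨t, ht, h⟩ hss
    exact ⟨t, ht, fun w hw => hss (h w hw)⟩
  inter_sets := by
    rintro s s' ⟨t, ht, h⟩ ⟨t', ht', h'⟩
    exact ⟨t * t', T.mul_mem ht ht', fun w hw =>
      ⟨h w (dvd_of_mul_right_dvd hw), h' w (dvd_of_mul_left_dvd hw)⟩⟩

theorem eventually_multiplesFilter {K : Type*} [CommRing K] {T : Submonoid K} {P : K → Prop} :
    (∀ᶠ w in multiplesFilter T, P w) ↔ ∃ t ∈ T, ∀ w, t ∣ w → P w := Iff.rfl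

variable (S : Submonoid (Subring.center R)) {Λ : AddSubgroup R}
  {𝒜 : ℕ → AddSubgroup R} [GradedRing 𝒜] {lam : R} {n : ℕ}

/-- The family ring localized at the norms of `S`. -/
abbrev LocFamily (Λ : AddSubgroup R) : Type _ :=
  LocalizedModule (familySubmonoid (normSubmonoid S Λ)) (FamilyRing Λ)

/-- The localization map of the family ring. -/
noncomputable abbrev locFamilyMap (Λ : AddSubgroup R) : FamilyRing Λ →+* LocFamily S Λ :=
  locMap (familySubmonoid (normSubmonoid S Λ))

theorem isUnit_locFamilyMap {t : formScalars Λ} (ht : t ∈ normSubmonoid S Λ) :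
    IsUnit (locFamilyMap S Λ (familyConst Λ (t.1 : R))) :=
  isUnit_locMap (familySubmonoid (normSubmonoid S Λ))
    ⟨((formScalars (familyParam Λ)).subtype.comp (familyConstScalar Λ)) t, t, ht, rfl⟩

theorem isUnit_locFamilyMap_of_mem (hΛ : IsFormParameter lam Λ) {z : Subring.center R}
    (hz : z ∈ S) : IsUnit (locFamilyMap S Λ (familyConst Λ (z : R))) := by
  have h := isUnit_locFamilyMap S (Λ := Λ)
    (t := ⟨z * centerStar z, norm_mem_formScalars hΛ z⟩) ⟨z, hz, rfl⟩
  have hc : Commute (locFamilyMap S Λ (familyConst Λ (z : R)))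
      (locFamilyMap S Λ (familyConst Λ (centerStar z : R))) := by
    rw [Commute, SemiconjBy, ← map_mul, ← map_mul, ← map_mul, ← map_mul, center_comm]
  rw [Subring.coe_mul, map_mul, map_mul, hc.isUnit_mul_iff] at h
  exact h.1

variable [IsStarStable S]

theorem isUnit_locFamilyHom (hΛ : IsFormParameter lam Λ)
    (hS : ∀ z ∈ S, (z : R) ∈ 𝒜 0) (w : formScalars Λ) (z : S) :
    IsUnit (((locFamilyMap S Λ).comp (familyHom Λ 𝒜 w)) ((z : Subring.center R) : R)) := by
  rw [RingHom.comp_apply, familyHom_of_mem_zero 𝒜 w (hS _ z.2)]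
  exact isUnit_locFamilyMap_of_mem S hΛ z.2

/-- The extension of `familyHom` to the localization. -/
noncomputable def locFamilyHom (hΛ : IsFormParameter lam Λ)
    (hS : ∀ z ∈ S, (z : R) ∈ 𝒜 0) (w : formScalars Λ) : LocalizedModule S R →+* LocFamily S Λ :=
  locLift S ((locFamilyMap S Λ).comp (familyHom Λ 𝒜 w)) (isUnit_locFamilyHom S hΛ hS w)

theorem locFamilyHom_locMap (hΛ : IsFormParameter lam Λ)
    (hS : ∀ z ∈ S, (z : R) ∈ 𝒜 0) (w : formScalars Λ) (a : R) :
    locFamilyHom S hΛ hS w (locMap S a) = locFamilyMap S Λ (familyHom Λ 𝒜 w a) :=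
  locLift_locMap S _ _ a

theorem const_mul_locFamilyHom_mk (hΛ : IsFormParameter lam Λ)
    (hS : ∀ z ∈ S, (z : R) ∈ 𝒜 0) (w : formScalars Λ) (a : R) (z : S) :
    locFamilyMap S Λ (familyConst Λ ((z : Subring.center R) : R)) *
      locFamilyHom S hΛ hS w (LocalizedModule.mk a z) =
      locFamilyMap S Λ (familyHom Λ 𝒜 w a) := by
  have h := mul_locLift_mk S ((locFamilyMap S Λ).comp (familyHom Λ 𝒜 w))
    (isUnit_locFamilyHom S hΛ hS w) a z
  rw [RingHom.comp_apply, familyHom_of_mem_zero 𝒜 w (hS _ z.2)] at h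
  exact h

/-- The denominator has degree zero, so both homomorphisms send it to the same unit, which can be
cancelled. -/
theorem locFamilyHom_sub_mk (hΛ : IsFormParameter lam Λ)
    (hS : ∀ z ∈ S, (z : R) ∈ 𝒜 0) (w : formScalars Λ) (a : R) (z : S) {x : LocFamily S Λ}
    (hx : locFamilyMap S Λ (familyConst Λ ((z : Subring.center R) : R)) * x =
      locFamilyMap S Λ (familyHom Λ 𝒜 w a - familyHom Λ 𝒜 0 a)) :
    locFamilyHom S hΛ hS w (LocalizedModule.mk a z) -
      locFamilyHom S hΛ hS 0 (LocalizedModule.mk a z) = x := by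
  refine (isUnit_locFamilyMap_of_mem S hΛ z.2).mul_left_cancel ?_
  rw [mul_sub, const_mul_locFamilyHom_mk, const_mul_locFamilyHom_mk, hx, map_sub]

variable (Λ) in
/-- The norms of `S` in the localized family ring. -/
noncomputable def locFamilyScalars : Submonoid (LocFamily S Λ) :=
  (familySubmonoid (normSubmonoid S Λ)).map
    ((locFamilyMap S Λ).comp (Subring.center (FamilyRing Λ)).subtype)

variable (Λ) in
/-- The image of the form parameter of the family ring in its localization. -/
noncomputable def locFamilyParam : AddSubgroup (LocFamily S Λ) :=
  (familyParam Λ).map (locFamilyMap S Λ).toAddMonoidHom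

theorem formLattice_locFamily (hΛ : IsFormParameter lam Λ) :
    FormLattice (locFamilyMap S Λ (familyConst Λ lam)) (locFamilyMap S Λ).range
      (locFamilyParam S Λ) (locFamilyScalars S Λ) :=
  formLattice_localization (familySubmonoid (normSubmonoid S Λ)) (isFormParameter_family Λ hΛ)
    (familySubmonoid_le _)

theorem mem_locFamilyScalars {t : formScalars Λ} (ht : t ∈ normSubmonoid S Λ) :
    locFamilyMap S Λ (familyConst Λ (t.1 : R)) ∈ locFamilyScalars S Λ :=
  ⟨_, ⟨t, ht, rfl⟩, rfl⟩

theorem exists_of_mem_locFamilyScalars {s : LocFamily S Λ} (hs : s ∈ locFamilyScalars S Λ) :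
    ∃ t ∈ normSubmonoid S Λ, s = locFamilyMap S Λ (familyConst Λ (t.1 : R)) := by
  obtain ⟨_, ⟨t, ht, rfl⟩, rfl⟩ := hs
  exact ⟨t, ht, rfl⟩

theorem exists_norm_eq (hΛ : IsFormParameter lam Λ) (z : S) :
    ∃ t ∈ normSubmonoid S Λ, (t.1 : R) =
      ((z : Subring.center R) : R) * star ((z : Subring.center R) : R) :=
  ⟨⟨_, norm_mem_formScalars hΛ z⟩, ⟨z, z.2, rfl⟩, rfl⟩

theorem locFamily_exists_den (c : LocFamily S Λ) :
    ∃ t ∈ locFamilyScalars S Λ, t * c ∈ (locFamilyMap S Λ).range := by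
  induction c using LocalizedModule.induction_on with
  | h a s => exact ⟨_, ⟨s.1, s.2, rfl⟩, a, (locMap_mul_mk _ a s).symm⟩

theorem isUnit_of_mem_locFamilyScalars {t : LocFamily S Λ} (ht : t ∈ locFamilyScalars S Λ) :
    IsUnit t := by
  obtain ⟨u, hu, rfl⟩ := exists_of_mem_locFamilyScalars S ht
  exact isUnit_locFamilyMap S hu

theorem locFamilyHom_star (hΛ : IsFormParameter lam Λ) (hgr : IsGradedForm 𝒜 lam Λ)
    (hS : ∀ z ∈ S, (z : R) ∈ 𝒜 0) (w : formScalars Λ) (x : LocalizedModule S R) :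
    locFamilyHom S hΛ hS w (star x) = star (locFamilyHom S hΛ hS w x) :=
  locLift_star S _ _ (fun a => by
    rw [RingHom.comp_apply, familyHom_star 𝒜 hgr, locMap_star]; rfl) x

theorem locFamilyHom_lam (hΛ : IsFormParameter lam Λ) (hgr : IsGradedForm 𝒜 lam Λ)
    (hS : ∀ z ∈ S, (z : R) ∈ 𝒜 0) (w : formScalars Λ) :
    locFamilyHom S hΛ hS w (locMap S lam) = locFamilyMap S Λ (familyConst Λ lam) := by
  rw [locFamilyHom_locMap, familyHom_of_mem_zero 𝒜 w hgr.lam_mem]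

/-- The denominators in `locParam` are norms, hence scalars that clear the fraction within the form
parameter. -/
theorem locFamilyHom_mem_fractions (hΛ : IsFormParameter lam Λ) (hgr : IsGradedForm 𝒜 lam Λ)
    (hS : ∀ z ∈ S, (z : R) ∈ 𝒜 0) {x : LocalizedModule S R} (hx : x ∈ locParam S Λ) :
    locFamilyHom S hΛ hS 0 x ∈
      FormLattice.fractions (locFamilyScalars S Λ) (locFamilyParam S Λ) := by
  have h := formLattice_locFamily S hΛ
  induction hx using AddSubgroup.closure_induction with
  | mem x hx =>
    obtain ⟨a, ha, z, rfl⟩ := hx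
    obtain ⟨t, ht, htz⟩ := exists_norm_eq S hΛ z
    refine ⟨_, mem_locFamilyScalars S ht, _, familyHom_mem_param 𝒜 hgr 0 ha, ?_⟩
    have hz : (((setStar S z * z : S) : Subring.center R) : R) = (t.1 : R) := by
      rw [htz, center_comm]; rfl
    rw [← hz]
    exact (const_mul_locFamilyHom_mk S hΛ hS 0 a _).symm
  | zero => exact ⟨1, Submonoid.one_mem _, by simp⟩
  | add x y _ _ hx hy =>
    obtain ⟨t, ht, htx⟩ := hx
    obtain ⟨u, hu, huy⟩ := hy
    refine ⟨t * u, Submonoid.mul_mem _ ht hu, ?_⟩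
    rw [map_add, mul_add]
    refine AddSubgroup.add_mem _ ?_ ?_
    · rw [h.central t ht, mul_assoc]; exact h.mul_mem u hu _ htx
    · rw [mul_assoc]; exact h.mul_mem t ht _ huy
  | neg x _ hx =>
    obtain ⟨t, ht, htx⟩ := hx
    refine ⟨t, ht, ?_⟩
    rw [map_neg, mul_neg]
    exact AddSubgroup.neg_mem _ htx

theorem eventually_locFamilyHom_sub_mem (hΛ : IsFormParameter lam Λ)
    (hS : ∀ z ∈ S, (z : R) ∈ 𝒜 0) {s : LocFamily S Λ} (hs : s ∈ locFamilyScalars S Λ)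
    (x : LocalizedModule S R) :
    ∀ᶠ w in multiplesFilter (normSubmonoid S Λ),
      locFamilyHom S hΛ hS w x - locFamilyHom S hΛ hS 0 x ∈
        (s * ·) '' ((locFamilyMap S Λ).range : Set (LocFamily S Λ)) := by
  obtain ⟨σ, hσ, rfl⟩ := exists_of_mem_locFamilyScalars S hs
  induction x using LocalizedModule.induction_on with
  | h a z =>
    obtain ⟨t, ht, htz⟩ := exists_norm_eq S hΛ z
    -- Here `t` is the norm of the denominator `z`: in a multiple of `σ * t`, one factor `z` cancels
    -- the denominator and `σ` remains as the scale.
    refine eventually_multiplesFilter.2 ⟨σ * t, Submonoid.mul_mem _ hσ ht, ?_⟩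
    rintro w ⟨v, rfl⟩
    obtain ⟨b, hb⟩ := exists_familyHom_sub 𝒜 (σ * t * v) a
    refine ⟨_, ⟨familyConst Λ (star ((z : Subring.center R) : R) * v.1) * b, rfl⟩, Eq.symm ?_⟩
    refine locFamilyHom_sub_mk S hΛ hS _ a z ?_
    have hw : ((σ * t * v).1 : R) = ((z : Subring.center R) : R) *
        ((σ.1 : R) * (star ((z : Subring.center R) : R) * v.1)) := by
      change (σ.1 : R) * t.1 * v.1 = _
      rw [htz, ← mul_assoc, ← mul_assoc, ← mul_assoc, center_comm σ.1]
    rw [hb, hw, map_mul (familyConst Λ) ((z : Subring.center R) : R),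
      map_mul (familyConst Λ) (σ.1 : R), mul_assoc, mul_assoc]
    beta_reduce
    rw [map_mul (locFamilyMap S Λ) (familyConst Λ (star _ * _)), map_mul (locFamilyMap S Λ)
      (familyConst Λ ((z : Subring.center R) : R)), map_mul (locFamilyMap S Λ),
      map_mul (locFamilyMap S Λ)]

theorem eventually_locFamilyHom_sub_mem_param (hΛ : IsFormParameter lam Λ)
    (hgr : IsGradedForm 𝒜 lam Λ) (hS : ∀ z ∈ S, (z : R) ∈ 𝒜 0) {s : LocFamily S Λ}
    (hs : s ∈ locFamilyScalars S Λ) {x : LocalizedModule S R} (hx : x ∈ locParam S Λ) :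
    ∀ᶠ w in multiplesFilter (normSubmonoid S Λ),
      locFamilyHom S hΛ hS w x - locFamilyHom S hΛ hS 0 x ∈
        (s * ·) '' (locFamilyParam S Λ : Set (LocFamily S Λ)) := by
  obtain ⟨σ, hσ, rfl⟩ := exists_of_mem_locFamilyScalars S hs
  induction hx using AddSubgroup.closure_induction with
  | mem x hx =>
    obtain ⟨a, ha, z, rfl⟩ := hx
    obtain ⟨t, ht, htz⟩ := exists_norm_eq S hΛ z
    refine eventually_multiplesFilter.2 ⟨σ * t, Submonoid.mul_mem _ hσ ht, ?_⟩
    -- The whole norm `t` is the denominator this time. The remaining factor is `σ * v`, and `v`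
    -- keeps the element inside the form parameter.
    rintro w ⟨v, rfl⟩
    obtain ⟨b, hbΓ, hb⟩ := exists_familyHom_sub_param 𝒜 hgr (σ * t * v) ha
    refine ⟨_, ⟨familyConst Λ (v.1 : R) * b, (familyConstScalar Λ v).2.2 b hbΓ, rfl⟩, Eq.symm ?_⟩
    refine locFamilyHom_sub_mk S hΛ hS _ a _ ?_
    have hw : ((σ * t * v).1 : R) = (t.1 : R) * ((σ.1 : R) * v.1) := by
      change (σ.1 : R) * t.1 * v.1 = _
      rw [← mul_assoc, center_comm σ.1]
    have hz : (((setStar S z * z : S) : Subring.center R) : R) = (t.1 : R) := by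
      rw [htz, center_comm]; rfl
    rw [hb, hw, hz, map_mul (familyConst Λ), map_mul (familyConst Λ) (σ.1 : R), mul_assoc,
      mul_assoc, map_mul (locFamilyMap S Λ), map_mul (locFamilyMap S Λ)]
    rfl
  | zero => exact Filter.Eventually.of_forall fun w => ⟨0, AddSubgroup.zero_mem _, by simp⟩
  | add x y _ _ hx hy =>
    filter_upwards [hx, hy] with w hwx hwy
    obtain ⟨p, hp, hp'⟩ := hwx
    obtain ⟨q, hq, hq'⟩ := hwy
    refine ⟨p + q, AddSubgroup.add_mem _ hp hq, ?_⟩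
    rw [map_add, map_add, add_sub_add_comm, ← hp', ← hq']
    exact mul_add _ _ _
  | neg x _ hx =>
    filter_upwards [hx] with w hwx
    obtain ⟨p, hp, hp'⟩ := hwx
    refine ⟨-p, AddSubgroup.neg_mem _ hp, ?_⟩
    rw [map_neg, map_neg, ← neg_sub', ← hp']
    exact _root_.mul_neg _ _

theorem scaledGroup_one_le_map :
    scaledGroup n (locFamilyMap S Λ (familyConst Λ lam)) (locFamilyMap S Λ).range
      (locFamilyParam S Λ) 1 ≤
      (elemGroup n (familyConst Λ lam) Set.univ (familyParam Λ : Set (FamilyRing Λ))).map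
        (glMap n (locFamilyMap S Λ)) := by
  refine le_trans (elemGroup_mono _ ?_ ?_)
    (elemGroup_image_le_map (locFamilyMap S Λ) (fun a => locMap_star _ a) _ _ _)
  · rintro _ ⟨_, ⟨x, rfl⟩, rfl⟩
    exact ⟨x, Set.mem_univ _, (one_mul _).symm⟩
  · rintro _ ⟨_, ⟨x, hx, rfl⟩, rfl⟩
    exact ⟨x, hx, (one_mul _).symm⟩

theorem glMap_locFamilyHom (hΛ : IsFormParameter lam Λ) (hS : ∀ z ∈ S, (z : R) ∈ 𝒜 0)
    (w : formScalars Λ) (α : (Matrix (Fin n ⊕ Fin n) (Fin n ⊕ Fin n) R)ˣ) :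
    glMap n (locFamilyHom S hΛ hS w) (locGL S n α) =
      glMap n (locFamilyMap S Λ) (glMap n (familyHom Λ 𝒜 w) α) := by
  ext i j
  exact locFamilyHom_locMap S hΛ hS w _

/-- Each entry of the difference is killed by some norm, and the product over the finitely many
entries kills them all. -/
theorem exists_torsion_of_glMap_eq
    {θ η : (Matrix (Fin n ⊕ Fin n) (Fin n ⊕ Fin n) (FamilyRing Λ))ˣ}
    (h : glMap n (locFamilyMap S Λ) η = glMap n (locFamilyMap S Λ) θ) :
    ∃ u ∈ normSubmonoid S Λ, ∀ i j, familyConst Λ (u.1 : R) * (θ.val i j - η.val i j) = 0 := by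
  have hent : ∀ i j, ∃ u ∈ normSubmonoid S Λ,
      familyConst Λ (u.1 : R) * (θ.val i j - η.val i j) = 0 := by
    intro i j
    have h0 : locFamilyMap S Λ (θ.val i j - η.val i j) = 0 := by
      rw [map_sub, sub_eq_zero]
      exact (congrArg (fun g => g.val i j) h).symm
    obtain ⟨_, ⟨u, hu, rfl⟩, hu0⟩ := locMap_eq_zero _ h0
    exact ⟨u, hu, hu0⟩
  choose d hd hd0 using hent
  refine ⟨∏ i, ∏ j, d i j, Submonoid.prod_mem _ fun i _ => Submonoid.prod_mem _ fun j _ => hd i j,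
    fun i j => ?_⟩
  obtain ⟨c, hc⟩ := (Finset.dvd_prod_of_mem (d i) (Finset.mem_univ j)).trans
    (Finset.dvd_prod_of_mem (fun i => ∏ j, d i j) (Finset.mem_univ i))
  have hc' : familyConst Λ ((∏ i, ∏ j, d i j).1 : R) =
      familyConst Λ (c.1 : R) * familyConst Λ ((d i j).1 : R) := by
    rw [hc, ← map_mul, mul_comm]; rfl
  rw [hc', mul_assoc, hd0, mul_zero]

/-- Convergence at scale `1` supplies `t` and an elementary `η` over the family ring, and the
comparison with `η` supplies the torsion bound `u`. Substituting multiples of `u` for the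
indeterminate yields the modulus `t * u`, valid at every base point. -/
theorem exists_dilate_mul_inv_mem (hΛ : IsFormParameter lam Λ) (hgr : IsGradedForm 𝒜 lam Λ)
    (hS : ∀ z ∈ S, (z : R) ∈ 𝒜 0) (hn : 3 ≤ n)
    (α : (Matrix (Fin n ⊕ Fin n) (Fin n ⊕ Fin n) R)ˣ)
    (hα : locGL S n α ∈ EQ n (locMap S lam) (locParam S Λ)) :
    ∃ t ∈ normSubmonoid S Λ, ∀ a b : formScalars Λ, t ∣ a - b →
      glMap n (dilate 𝒜 a) α * (glMap n (dilate 𝒜 b) α)⁻¹ ∈ EQ n lam Λ := by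
  rw [EQ_eq_elemGroup] at hα
  have main := (formLattice_locFamily S hΛ).eventually_glMap_mul_inv_mem hn
    (locFamily_exists_den S) (fun t => isUnit_of_mem_locFamilyScalars S)
    (multiplesFilter (normSubmonoid S Λ))
    (locFamilyHom (𝒜 := 𝒜) S hΛ hS) (locFamilyHom (𝒜 := 𝒜) S hΛ hS 0)
    (locFamilyHom_star S hΛ hgr hS) (locFamilyHom_star S hΛ hgr hS 0)
    (locFamilyHom_lam S hΛ hgr hS) (locFamilyHom_lam S hΛ hgr hS 0)
    (Δ := (locParam S Λ : Set (LocalizedModule S R)))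
    (fun a => locFamilyHom_mem_fractions S hΛ hgr hS)
    (fun s hs => eventually_locFamilyHom_sub_mem S hΛ hS hs)
    (fun s hs a => eventually_locFamilyHom_sub_mem_param S hΛ hgr hS hs) hα 1
    (Submonoid.one_mem _)
  obtain ⟨t, ht, htw⟩ := eventually_multiplesFilter.1 main
  have hmem := htw t dvd_rfl
  rw [glMap_locFamilyHom, glMap_locFamilyHom, ← map_inv, ← map_mul] at hmem
  obtain ⟨η, hη, hηθ⟩ := scaledGroup_one_le_map S hmem
  obtain ⟨u, hu, hu0⟩ := exists_torsion_of_glMap_eq S hηθ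
  refine ⟨t * u, Submonoid.mul_mem _ ht hu, fun a b hab => ?_⟩
  obtain ⟨v, hv⟩ := hab
  have hab' : a = b + t * (u * v) := by
    rw [← mul_assoc, ← hv, add_sub_cancel]
  rw [hab']
  exact dilate_mul_inv_mem_of_torsion 𝒜 α t u hη hu0 b v

end Local

/-! ### The ideal of dilation moduli and the conclusion. -/

section Main

variable {R : Type*} [Ring R] [StarRing R] {𝒜 : ℕ → AddSubgroup R} [GradedRing 𝒜]
  {lam : R} {Λ : AddSubgroup R} {n : ℕ}

theorem coe_mem_zero_of_mem_locSet (m : MaximalSpectrum (Subring.center (𝒜 0)))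
    (z : Subring.center R) (hz : z ∈ locSet 𝒜 m) : (z : R) ∈ 𝒜 0 := by
  obtain ⟨c, hc, -⟩ := hz.1
  rw [← hc]
  exact SetLike.coe_mem _

/-- The scalars modulo which dilations of `α` are constant up to elementary matrices. -/
def dilationIdeal (𝒜 : ℕ → AddSubgroup R) [GradedRing 𝒜] (lam : R) (Λ : AddSubgroup R)
    (α : (Matrix (Fin n ⊕ Fin n) (Fin n ⊕ Fin n) R)ˣ) : Ideal (formScalars Λ) where
  carrier := {z | ∀ a b : formScalars Λ, z ∣ a - b →
    glMap n (dilate 𝒜 a) α * (glMap n (dilate 𝒜 b) α)⁻¹ ∈ EQ n lam Λ}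
  zero_mem' := by
    intro a b hab
    rw [zero_dvd_iff, sub_eq_zero] at hab
    rw [hab, mul_inv_cancel]
    exact Subgroup.one_mem _
  add_mem' := by
    rintro y z hy hz a b ⟨c, hc⟩
    -- The intermediate point `a - y * c` differs from `a` by a multiple of `y` and from `b` by a
    -- multiple of `z`.
    have h1 := hy a (a - y * c) ⟨c, by ring⟩
    have h2 := hz (a - y * c) b ⟨c, by linear_combination hc⟩
    simpa using Subgroup.mul_mem _ h1 h2
  smul_mem' := by
    intro x z hz a b hab
    exact hz a b ((Dvd.intro_left x rfl).trans hab)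

theorem glMap_dilate_one (α : (Matrix (Fin n ⊕ Fin n) (Fin n ⊕ Fin n) R)ˣ) :
    glMap n (dilate 𝒜 (1 : formScalars Λ)) α = α := by
  ext i j
  exact gscale_id_one 𝒜 _

theorem glMap_dilate_zero (α : (Matrix (Fin n ⊕ Fin n) (Fin n ⊕ Fin n) R)ˣ)
    (hα : ∀ i j, (α.val - 1) i j ∈ HomogeneousIdeal.irrelevant 𝒜) :
    glMap n (dilate 𝒜 (0 : formScalars Λ)) α = 1 := by
  ext i j
  rw [glMap_val_apply]
  have h1 := (HomogeneousIdeal.mem_irrelevant_iff 𝒜 _).1 (hα i j)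
  rw [Matrix.sub_apply, map_sub, sub_eq_zero] at h1
  have h2 : dilate 𝒜 (0 : formScalars Λ) (α.val i j) = GradedRing.proj 𝒜 0 (α.val i j) :=
    gscale_zero 𝒜 (RingHom.id R) _
  rw [h2, h1, Units.val_one, Matrix.one_apply, GradedRing.proj_apply]
  split_ifs
  · exact DirectSum.decompose_of_mem_same 𝒜 (SetLike.one_mem_graded 𝒜)
  · simp

end Main

end GradedLG

theorem mainTheorem6 {R : Type*} [Ring R] [StarRing R]
    (𝒜 : ℕ → AddSubgroup R) [GradedRing 𝒜]
    (hfin : Module.Finite (Subring.center R) R)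
    (lam : R) (Λ : AddSubgroup R) (hΛ : IsFormParameter lam Λ) (hgr : IsGradedForm 𝒜 lam Λ)
    (n : ℕ) (hn : 3 ≤ n)
    (α : (Matrix (Fin n ⊕ Fin n) (Fin n ⊕ Fin n) R)ˣ) (hα : α ∈ GQ n lam)
    (hα_one : ∀ i j, (α.val - 1) i j ∈ HomogeneousIdeal.irrelevant 𝒜)
    (hloc : ∀ m : MaximalSpectrum (Subring.center (𝒜 0)),
      locGL (locSet 𝒜 m) n α ∈
        EQ n (locMap (locSet 𝒜 m) lam) (locParam (locSet 𝒜 m) Λ)) :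
    α ∈ EQ n lam Λ := by
  -- The ideal is restricted to degree zero, where its elements can be compared with the maximal
  -- ideals of `C(R_0)`.
  let Q : Ideal (gradedScalars 𝒜 Λ) :=
    (dilationIdeal 𝒜 lam Λ α).comap (gradedScalars 𝒜 Λ).subtype
  by_cases hQ : Q = ⊤
  · have h1 : (1 : gradedScalars 𝒜 Λ) ∈ Q := by rw [hQ]; exact Submodule.mem_top
    have h2 := h1 1 0 (one_dvd _)
    rwa [glMap_dilate_one, glMap_dilate_zero α hα_one, inv_one, mul_one] at h2
  · exfalso
    obtain ⟨P, hP, hQP⟩ := Ideal.exists_le_maximal Q hQ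
    obtain ⟨m, hm⟩ := exists_maximal_over hΛ hgr P
    obtain ⟨t, ⟨z, hz, htz⟩, ht⟩ := exists_dilate_mul_inv_mem (locSet 𝒜 m) hΛ hgr
      (coe_mem_zero_of_mem_locSet m) hn α (hloc m)
    -- The norm `t = z * star z` is a product of two elements outside the prime ideal `m`, yet it
    -- lies in `Q`, hence in `P` and so in `m`.
    obtain ⟨c, hc, hcm⟩ := hz.1.mul hz.2
    have htR : (t.1 : R) = ((c : 𝒜 0) : R) := by rw [hc, htz]; rfl
    have ht0 : (t.1 : R) ∈ 𝒜 0 := by rw [htR]; exact SetLike.coe_mem _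
    have := hm ⟨t, ht0⟩ (hQP ht)
    refine hcm ?_
    convert this using 1
    exact Subtype.ext (Subtype.ext htR.symm)
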